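/- For $n \ge 1$ let $S_{\rm div}(n)$ be the set of permutations $\pi$ of $\{1,2,\dots,n\}$ such that for each $1\le j\le n$ either $j\mid \pi(j)$ or $\pi(j)\mid j$. Then the limit $$c_d=\lim_{n\to\infty}\bigl(\#S_{\rm div}(n)\bigr)^{1/n}$$ exists and is an effectively computable real number (that is, there is an algorithm which, given $k\in\mathbb{N}$, outputs a rational number within $2^{-k}$ of $c_d$). Moreover, for every $\epsilon>0$, $$\#S_{\rm div}(n)=c_d^{\,n\left(1+O_\epsilon\left(\exp\left((-1+\epsilon)\sqrt{\log n\,\log\log n}\right)\right)\right)}\qquad (n\to\infty),$$ where the implied constant may depend on $\epsilon$. -/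

import Mathlib

/-- The set of permutations `π` of `{1, …, n}` such that, for each `j` in `{1, …, n}`,
either `j ∣ π j` or `π j ∣ j`. -/
def Sdiv (n : ℕ) : Finset (Equiv.Perm (Finset.Icc 1 n)) :=
  Finset.univ.filter fun π => ∀ j : Finset.Icc 1 n, (j : ℕ) ∣ (π j : ℕ) ∨ (π j : ℕ) ∣ (j : ℕ)

/-- A real number `x` is (effectively) computable if some algorithm, given `k`, outputs integers
`p k` and `q k > 0` such that the rational number `p k / q k` is within `2 ^ (-k)` of `x`. -/
def IsEffectivelyComputable (x : ℝ) : Prop :=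
  ∃ (p : ℕ → ℤ) (q : ℕ → ℕ), Computable p ∧ Computable q ∧
    ∀ k : ℕ, 0 < q k ∧ |x - (p k : ℝ) / (q k : ℝ)| ≤ 1 / 2 ^ k

/-! Peel the integers off {1, …, n} from below: log #S_div(n) is the sum over m of the logarithmic
gain in the number of admissible permutations when m is adjoined to (m, n]. Two facts control this
gain.

It is local (`gain_eq_smoothGain`). Let k = ⌊n/m⌋ and m = s·b, where s has only prime factors ≤ k
and b has none. Related integers in [m, n] have quotient at most k, so the numbers b·t with t
k-smooth are not joined to the rest of [m, n] in the divisibility graph, and the rest cancels. The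
gain depends only on k, s and ⌊n/b⌋.

It is small (`coverCount_insert_le`). A new vertex with d neighbours multiplies the count by at most
1 + 2d², so the gain is O(log k) for k ≥ 2. Indeed, permutations with prescribed i → m → j are at
most twice as many as those avoiding m (`ncard_permsThrough_le`): pairs of them are mapped
injectively to pairs avoiding m by switching along an alternating cycle.

Hence the layer ⌊n/m⌋ = k contributes n·`layerDensity k` up to an error. Brun's sieve counts the
rough parts b when s is small, and Rankin's trick bounds the contribution of large s
(`layer_error_le`). The densities are O((log k + 1)/k²); their sum is `logGrowth`, and c_d = exp
`logGrowth`.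

Put X = log n and S = √(X log X). Layers k > e^S are discarded at relative cost e^(-S), up to
logarithms. For the others a Rankin exponent near log X / (2 log k), capped for small k, gives an
error of about (n/k)·exp(-X log X / (4 log k) - log k), and AM-GM bounds the exponential by e^(-S),
with equality at log k = S/2. This is the source of the constant -1.

For computability, the count is primitive recursive in n, and the convergence rate tells how large n
must be for the n-th root to approximate c_d to a prescribed accuracy. -/

/-! ### Splitting a cycle by a transposition -/

open Equiv in
theorem Equiv.Perm.SameCycle.mem_iff_of_invariant {α : Type*} {f : Perm α} {x y : α}
    (h : f.SameCycle x y) {Y : Set α} (hY : ∀ z, f z ∈ Y ↔ z ∈ Y) : x ∈ Y ↔ y ∈ Y := by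
  have hn : ∀ (n : ℕ) z, (f ^ n) z ∈ Y ↔ z ∈ Y := by
    intro n
    induction n with
    | zero => simp
    | succ n ih => intro z; rw [pow_succ, Perm.mul_apply, ih, hY]
  obtain ⟨i, rfl⟩ := h
  obtain ⟨n, rfl | rfl⟩ := i.eq_nat_or_neg
  · rw [zpow_natCast, hn]
  · rw [← hn n ((f ^ (-(n : ℤ))) x), ← Perm.mul_apply, ← zpow_natCast, ← zpow_add]; simp

-- Let t be the first time the orbit of `y` reaches `x`. The set {f y, …, f^t y = x} is stable under
-- `f * swap x y`, which sends `x` to `f y` and acts as `f` on the other points. It contains `x` but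
-- not `y`.
open Equiv in
theorem not_sameCycle_mul_swap_of_pow {α : Type*} [DecidableEq α] {f : Perm α} {x y : α}
    (hxy : x ≠ y) {n : ℕ} (hn : (f ^ n) y = x) : ¬ (f * swap x y).SameCycle x y := by
  classical
  have hex : ∃ n : ℕ, (f ^ n) y = x := ⟨n, hn⟩
  set t := Nat.find hex with ht
  have htx : (f ^ t) y = x := Nat.find_spec hex
  have htmin : ∀ s < t, (f ^ s) y ≠ x := fun s hs => Nat.find_min hex hs
  have ht1 : 1 ≤ t := by
    by_contra h
    have : t = 0 := by omega
    rw [this] at htx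
    exact hxy (by simpa using htx.symm)
  have hy : ∀ s, 1 ≤ s → s ≤ t → (f ^ s) y ≠ y := by
    intro s h1 h2 h3
    apply htmin (t - s) (by omega)
    have : (f ^ (t - s)) ((f ^ s) y) = x := by
      rw [← Perm.mul_apply, ← pow_add, Nat.sub_add_cancel h2, htx]
    rwa [h3] at this
  set Y : Finset α := (Finset.Icc 1 t).image (fun s => (f ^ s) y) with hYdef
  have hmem : ∀ z, z ∈ Y ↔ ∃ s, (1 ≤ s ∧ s ≤ t) ∧ (f ^ s) y = z := by
    intro z; simp [hYdef]
  have hmaps : ∀ z ∈ Y, (f * swap x y) z ∈ Y := by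
    intro z hz
    obtain ⟨s, ⟨h1, h2⟩, rfl⟩ := (hmem z).1 hz
    rcases eq_or_lt_of_le h2 with h | h
    · rw [h, htx, Perm.mul_apply, swap_apply_left]
      exact (hmem _).2 ⟨1, ⟨le_refl _, ht1⟩, by simp⟩
    · rw [Perm.mul_apply, swap_apply_of_ne_of_ne (htmin s h) (hy s h1 h2)]
      exact (hmem _).2 ⟨s + 1, ⟨by omega, h⟩, by rw [pow_succ', Perm.mul_apply]⟩
  have himg : Y.image (f * swap x y) = Y := by
    apply Finset.eq_of_subset_of_card_le
    · intro z hz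
      obtain ⟨w, hw, rfl⟩ := Finset.mem_image.1 hz
      exact hmaps w hw
    · rw [Finset.card_image_of_injective _ (f * swap x y).injective]
  intro hsc
  have := hsc.mem_iff_of_invariant (Y := (Y : Set α)) (by
    intro z
    simp only [Finset.mem_coe]
    refine ⟨fun h => ?_, hmaps z⟩
    rw [← himg] at h
    obtain ⟨w, hw, hwz⟩ := Finset.mem_image.1 h
    rwa [← (f * swap x y).injective hwz])
  have hx : x ∈ Y := (hmem x).2 ⟨t, ⟨ht1, le_refl _⟩, htx⟩
  obtain ⟨s, ⟨h1, h2⟩, h3⟩ := (hmem y).1 (this.1 hx)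
  exact hy s h1 h2 h3

open Equiv in
theorem Equiv.Perm.SameCycle.not_sameCycle_mul_swap {α : Type*} [DecidableEq α] {f : Perm α}
    {x y : α} (hxy : x ≠ y) (h : f.SameCycle x y) : ¬ (f * swap x y).SameCycle x y := by
  obtain ⟨i, hi⟩ := h
  obtain ⟨n, rfl | rfl⟩ := i.eq_nat_or_neg
  · rw [zpow_natCast] at hi
    intro hs
    rw [swap_comm] at hs
    exact not_sameCycle_mul_swap_of_pow hxy.symm hi hs.symm
  · apply not_sameCycle_mul_swap_of_pow hxy (n := n)
    rw [← hi, ← Perm.mul_apply, ← zpow_natCast, ← zpow_add]; simp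

/-! ### Switching two permutations along a cycle -/

section Switch

open Equiv Classical

variable {α : Type*} (a b : Perm α) (x : α)

/-- The cycle through `x` of the permutation comparing `a` and `b`. -/
noncomputable def switchCycle : Perm α := (a⁻¹ * b).cycleOf x

/-- The switch exchanges the values of `a` and `b` on a single orbit of `a⁻¹ * b`. Any pointwise
condition satisfied by both therefore survives it. -/
theorem mul_switchCycle_apply (y : α) :
    (a * switchCycle a b x) y = if (a⁻¹ * b).SameCycle x y then b y else a y := by
  rw [Perm.mul_apply, switchCycle, Perm.cycleOf_apply]
  split_ifs <;> simp

theorem mul_switchCycle_inv_apply (y : α) :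
    (b * (switchCycle a b x)⁻¹) y = if (a⁻¹ * b).SameCycle x y then a y else b y := by
  rw [Perm.mul_apply, switchCycle, Perm.cycleOf_inv, Perm.cycleOf_apply]
  simp only [Perm.sameCycle_inv]
  split_ifs <;> simp

/-- The switched pair, compared in reverse order, gives `c * κ⁻¹ * c`. On the orbit of `x` this is
`c`, because `c` and `κ` agree there. So the switched pair determines the cycle, and the switch can
be undone. -/
theorem switchCycle_switch :
    ((b * (switchCycle a b x)⁻¹)⁻¹ * (a * switchCycle a b x)).cycleOf x = switchCycle a b x := by
  set c := switchCycle a b x with hc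
  set κ := a⁻¹ * b with hκ
  have hcomm : Commute c κ := by
    ext y
    simp only [Perm.mul_apply, hc, switchCycle, ← hκ, Perm.cycleOf_apply, Perm.sameCycle_apply_right]
    split_ifs <;> rfl
  have hrw : (b * c⁻¹)⁻¹ * (a * c) = c * (κ⁻¹ * c) := by
    rw [hκ]; group
  rw [hrw, Perm.cycleOf_mul_of_apply_right_eq_self]
  · by_cases hx : κ x = x
    · have : c = 1 := by rw [hc, switchCycle]; exact (Perm.cycleOf_eq_one_iff _).2 hx
      ext y; rw [Perm.cycleOf_apply, this]; simp
    · have hcyc : c.IsCycle := Perm.isCycle_cycleOf κ hx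
      apply hcyc.cycleOf_eq
      rw [hc, switchCycle, Perm.cycleOf_apply_self]; exact hx
  · exact (hcomm.inv_right).mul_right (Commute.refl c)
  · rw [Perm.mul_apply, hc, switchCycle, Perm.cycleOf_apply_self, ← hκ, ← Perm.mul_apply, inv_mul_cancel, Perm.one_apply]

theorem switch_injective :
    Function.Injective fun p : Perm α × Perm α =>
      (p.1 * switchCycle p.1 p.2 x, p.2 * (switchCycle p.1 p.2 x)⁻¹) := by
  rintro ⟨a, b⟩ ⟨a', b'⟩ h
  simp only [Prod.mk.injEq] at h
  have hc : switchCycle a b x = switchCycle a' b' x := by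
    rw [← switchCycle_switch a b x, ← switchCycle_switch a' b' x, h.1, h.2]
  rw [hc] at h
  exact Prod.ext (mul_right_cancel h.1) (mul_right_cancel h.2)

end Switch

/-! ### Effect of one new vertex on the number of permutations -/

section PermsIn

open Equiv Classical

variable {α : Type*}

/-- The permutations supported on `S` that move every element to a related one. -/
def permsIn (R : α → α → Prop) (S : Finset α) : Set (Perm α) :=
  {π | (∀ x, R x (π x)) ∧ ∀ x ∉ S, π x = x}

theorem finite_permsIn (R : α → α → Prop) (S : Finset α) : (permsIn R S).Finite := by
  have h : Set.Finite (Set.range fun f : Perm S => Perm.ofSubtype f) := Set.finite_range _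
  apply h.subset
  intro π hπ
  have hS : ∀ x, x ∈ S ↔ π x ∈ S := by
    intro x
    constructor
    · intro hx
      by_contra h
      have := hπ.2 _ h
      exact h ((π.injective this).symm ▸ hx)
    · intro hx
      by_contra h
      rw [hπ.2 _ h] at hx
      exact h hx
  refine ⟨π.subtypePerm (p := (· ∈ S)) (fun x => (hS x).symm), ?_⟩
  ext x
  by_cases hx : x ∈ S
  · rw [Perm.ofSubtype_apply_of_mem _ hx]; rfl
  · rw [Perm.ofSubtype_apply_of_not_mem _ hx, hπ.2 x hx]

theorem one_mem_permsIn {R : α → α → Prop} (hR : ∀ x, R x x) (S : Finset α) :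
    (1 : Perm α) ∈ permsIn R S := ⟨fun x => hR x, fun _ _ => rfl⟩

theorem permsIn_mono {R : α → α → Prop} {S T : Finset α} (h : S ⊆ T) :
    permsIn R S ⊆ permsIn R T := fun _ hπ => ⟨hπ.1, fun x hx => hπ.2 x fun h' => hx (h h')⟩

theorem ncard_permsIn_pos {R : α → α → Prop} (hR : ∀ x, R x x) (S : Finset α) :
    0 < (permsIn R S).ncard :=
  (Set.ncard_pos (finite_permsIn R S)).2 ⟨1, one_mem_permsIn hR S⟩

/-- Permutations in `insert m S` whose cycle passes through `i → m → j`. -/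
def permsThrough (R : α → α → Prop) (S : Finset α) (m i j : α) : Set (Perm α) :=
  {π | π ∈ permsIn R (insert m S) ∧ π i = m ∧ π m = j}

theorem inv_apply_eq_of {π : Perm α} {x y : α} (h : π x = y) : π⁻¹ y = x := by
  rw [← h, ← Perm.mul_apply, inv_mul_cancel, Perm.one_apply]

theorem rel_inv_apply {R : α → α → Prop} (hs : ∀ x y, R x y → R y x) {π : Perm α}
    (h : ∀ x, R x (π x)) (x : α) : R x (π⁻¹ x) := by
  have := h (π⁻¹ x)
  rw [← Perm.mul_apply, mul_inv_cancel, Perm.one_apply] at this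
  exact hs _ _ this

variable {R : α → α → Prop} (hR : ∀ x, R x x) (hs : ∀ x y, R x y → R y x)
  {S : Finset α} {m i j : α}

/-- Since κ j = i, if `m` and `i` share a κ-cycle then so do `m` and `j`. Multiplying by `swap m j`
splits that cycle between `m` and `j`. The second comparison permutation is the result with `m` cut
out in front of its image `i`, so `i` and `j` stay apart. -/
theorem sameCycle_dichotomy (hj : j ≠ m) {a b : Perm α} (hai : a i = m) (hbj : b j = m) :
    ¬ (a⁻¹ * b).SameCycle m i ∨
      ¬ ((a * swap m i)⁻¹ * (b * swap m j)).SameCycle i j := by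
  by_contra hcon
  push Not at hcon
  obtain ⟨h1, h2⟩ := hcon
  set κ := a⁻¹ * b with hκ
  have hκj : κ j = i := by rw [hκ, Perm.mul_apply, hbj, inv_apply_eq_of hai]
  have h3 : κ.SameCycle m j := by
    rw [← hκj] at h1
    exact Perm.sameCycle_apply_right.1 h1
  have h4 := h3.not_sameCycle_mul_swap hj.symm
  set κ' := κ * swap m j with hκ'
  have hκ'm : κ' m = i := by rw [hκ', Perm.mul_apply, swap_apply_left, hκj]
  have hrw : (a * swap m i)⁻¹ * (b * swap m j) = swap m i * κ' := by
    rw [hκ', hκ, mul_inv_rev, swap_inv]; group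
  rw [hrw] at h2
  have hmi : κ'.SameCycle m i := by rw [← hκ'm]; exact Perm.sameCycle_apply_right.2 (.refl _ _)
  have := h2.mem_iff_of_invariant (Y := {y | κ'.SameCycle m y}) (by
    intro z
    simp only [Set.mem_ofPred_eq, Perm.mul_apply]
    rw [← Perm.sameCycle_apply_right (f := κ') (y := z)]
    by_cases hz1 : κ' z = m
    · rw [hz1, swap_apply_left]; exact ⟨fun _ => .refl _ _, fun _ => hmi⟩
    by_cases hz2 : κ' z = i
    · rw [hz2, swap_apply_right]; exact ⟨fun _ => hmi, fun _ => .refl _ _⟩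
    rw [swap_apply_of_ne_of_ne hz1 hz2])
  exact h4 (this.1 hmi)

-- Compare π (i → m → j) with σ⁻¹ (j → m → i). Switching along the cycle of `m`, which here contains
-- neither `i` nor `j`, creates the 2-cycle m ↔ i in one permutation and m ↔ j in the other. The
-- final transpositions delete these 2-cycles and leave permutations of `S`.
include hR hs in
theorem ncard_permsThrough_far :
    {p : Perm α × Perm α | (p.1 ∈ permsThrough R S m i j ∧ p.2 ∈ permsThrough R S m i j) ∧
      ¬ (p.1⁻¹ * p.2⁻¹).SameCycle m i}.ncard ≤ (permsIn R S).ncard ^ 2 := by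
  rw [sq, ← Set.ncard_prod]
  refine Set.ncard_le_ncard_of_injOn
    (fun p => (p.1 * switchCycle p.1 p.2⁻¹ m * swap m i,
      p.2⁻¹ * (switchCycle p.1 p.2⁻¹ m)⁻¹ * swap m j)) ?_ ?_
    ((finite_permsIn R S).prod (finite_permsIn R S))
  · rintro ⟨π, σ⟩ ⟨⟨⟨⟨hπR, hπS⟩, hπi, hπm⟩, ⟨⟨hσR, hσS⟩, hσi, hσm⟩⟩, hnot⟩
    simp only at *
    have hσ' : ∀ x, R x (σ⁻¹ x) := rel_inv_apply hs hσR
    have hσj : σ⁻¹ j = m := inv_apply_eq_of hσm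
    have hσm' : σ⁻¹ m = i := inv_apply_eq_of hσi
    have hκj : (π⁻¹ * σ⁻¹) j = i := by rw [Perm.mul_apply, hσj, inv_apply_eq_of hπi]
    have hnotj : ¬ (π⁻¹ * σ⁻¹).SameCycle m j := by
      rw [← Perm.sameCycle_apply_right, hκj]; exact hnot
    have hfix : ∀ x, x ∉ S → x ≠ m → π x = x ∧ σ⁻¹ x = x := by
      intro x hx hxm
      have : x ∉ insert m S := by simp [hx, hxm]
      exact ⟨hπS x this, inv_apply_eq_of (hσS x this)⟩
    refine ⟨⟨fun x => ?_, fun x hx => ?_⟩, ⟨fun x => ?_, fun x hx => ?_⟩⟩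
    · simp only
      rw [Perm.mul_apply, mul_switchCycle_apply]
      by_cases hxm : x = m
      · rw [hxm, swap_apply_left, if_neg hnot, hπi]; exact hR _
      by_cases hxi : x = i
      · rw [hxi, swap_apply_right, if_pos (.refl _ _), hσm']; exact hR _
      rw [swap_apply_of_ne_of_ne hxm hxi]
      split_ifs
      exacts [hσ' x, hπR x]
    · simp only
      rw [Perm.mul_apply, mul_switchCycle_apply]
      by_cases hxm : x = m
      · rw [hxm, swap_apply_left, if_neg hnot, hπi]
      by_cases hxi : x = i
      · rw [hxi, swap_apply_right, if_pos (.refl _ _), hσm']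
      rw [swap_apply_of_ne_of_ne hxm hxi]
      split_ifs
      exacts [(hfix x hx hxm).2, (hfix x hx hxm).1]
    · simp only
      rw [Perm.mul_apply, mul_switchCycle_inv_apply]
      by_cases hxm : x = m
      · rw [hxm, swap_apply_left, if_neg hnotj, hσj]; exact hR _
      by_cases hxi : x = j
      · rw [hxi, swap_apply_right, if_pos (.refl _ _), hπm]; exact hR _
      rw [swap_apply_of_ne_of_ne hxm hxi]
      split_ifs
      exacts [hπR x, hσ' x]
    · simp only
      rw [Perm.mul_apply, mul_switchCycle_inv_apply]
      by_cases hxm : x = m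
      · rw [hxm, swap_apply_left, if_neg hnotj, hσj]
      by_cases hxi : x = j
      · rw [hxi, swap_apply_right, if_pos (.refl _ _), hπm]
      rw [swap_apply_of_ne_of_ne hxm hxi]
      split_ifs
      exacts [(hfix x hx hxm).1, (hfix x hx hxm).2]
  · rintro ⟨π, σ⟩ - ⟨π', σ'⟩ - h
    simp only [Prod.mk.injEq] at h
    have := switch_injective m (a₁ := (π, σ⁻¹)) (a₂ := (π', σ'⁻¹))
      (Prod.ext (mul_right_cancel h.1) (mul_right_cancel h.2))
    simpa using this

-- Cutting `m` out first produces the shortcuts i → j and j → i, which need not be related pairs.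
-- Switching along the cycle of `i`, which avoids `j`, moves both shortcuts into one permutation,
-- where they form a 2-cycle that `swap i j` deletes.
include hs in
theorem ncard_permsThrough_near (hiS : i ∈ S) (hjS : j ∈ S) (hR : ∀ x, R x x) :
    {p : Perm α × Perm α | (p.1 ∈ permsThrough R S m i j ∧ p.2 ∈ permsThrough R S m i j) ∧
      ¬ ((p.1 * swap m i)⁻¹ * (p.2⁻¹ * swap m j)).SameCycle i j}.ncard
      ≤ (permsIn R S).ncard ^ 2 := by
  rw [sq, ← Set.ncard_prod]
  refine Set.ncard_le_ncard_of_injOn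
    (fun p => (p.1 * swap m i * switchCycle (p.1 * swap m i) (p.2⁻¹ * swap m j) i,
      p.2⁻¹ * swap m j * (switchCycle (p.1 * swap m i) (p.2⁻¹ * swap m j) i)⁻¹ * swap i j)) ?_ ?_
    ((finite_permsIn R S).prod (finite_permsIn R S))
  · rintro ⟨π, σ⟩ ⟨⟨⟨⟨hπR, hπS⟩, hπi, hπm⟩, ⟨⟨hσR, hσS⟩, hσi, hσm⟩⟩, hnot⟩
    simp only at *
    have hσ' : ∀ x, R x (σ⁻¹ x) := rel_inv_apply hs hσR
    have hσj : σ⁻¹ j = m := inv_apply_eq_of hσm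
    have hfix : ∀ x, x ∉ S → x ≠ m → π x = x ∧ σ⁻¹ x = x := by
      intro x hx hxm
      have : x ∉ insert m S := by simp [hx, hxm]
      exact ⟨hπS x this, inv_apply_eq_of (hσS x this)⟩
    set a := π * swap m i with ha
    set b := σ⁻¹ * swap m j with hb
    have ham : a m = m := by rw [ha, Perm.mul_apply, swap_apply_left, hπi]
    have hbm : b m = m := by rw [hb, Perm.mul_apply, swap_apply_left, hσj]
    have hai : a i = j := by rw [ha, Perm.mul_apply, swap_apply_right, hπm]
    have hbj : b j = i := by
      rw [hb, Perm.mul_apply, swap_apply_right, inv_apply_eq_of hσi]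
    have ha' : ∀ x, x ≠ m → x ≠ i → a x = π x := fun x h1 h2 => by
      rw [ha, Perm.mul_apply, swap_apply_of_ne_of_ne h1 h2]
    have hb' : ∀ x, x ≠ m → x ≠ j → b x = σ⁻¹ x := fun x h1 h2 => by
      rw [hb, Perm.mul_apply, swap_apply_of_ne_of_ne h1 h2]
    have hnot' : ¬ (a⁻¹ * b).SameCycle j i := fun h => hnot h.symm
    refine ⟨⟨fun x => ?_, fun x hx => ?_⟩, ⟨fun x => ?_, fun x hx => ?_⟩⟩
    · simp only
      rw [mul_switchCycle_apply]
      by_cases hxm : x = m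
      · rw [hxm, ham, hbm, ite_self]; exact hR _
      split_ifs with hsc
      · rw [hb' x hxm (fun h => hnot (h ▸ hsc))]; exact hσ' x
      · rw [ha' x hxm (fun h => hsc (h ▸ .refl _ _))]; exact hπR x
    · simp only
      rw [mul_switchCycle_apply]
      by_cases hxm : x = m
      · rw [hxm, ham, hbm, ite_self]
      rw [ha' x hxm (fun h => hx (h ▸ hiS)), hb' x hxm (fun h => hx (h ▸ hjS)),
        (hfix x hx hxm).1, (hfix x hx hxm).2, ite_self]
    · simp only
      rw [Perm.mul_apply, mul_switchCycle_inv_apply]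
      by_cases hxi : x = i
      · rw [hxi, swap_apply_left, if_neg hnot, hbj]; exact hR _
      by_cases hxj : x = j
      · rw [hxj, swap_apply_right, if_pos (.refl _ _), hai]; exact hR _
      rw [swap_apply_of_ne_of_ne hxi hxj]
      by_cases hxm : x = m
      · rw [hxm, ham, hbm, ite_self]; exact hR _
      rw [ha' x hxm hxi, hb' x hxm hxj]
      split_ifs
      exacts [hπR x, hσ' x]
    · simp only
      have hxi : x ≠ i := fun h => hx (h ▸ hiS)
      have hxj : x ≠ j := fun h => hx (h ▸ hjS)
      rw [Perm.mul_apply, mul_switchCycle_inv_apply, swap_apply_of_ne_of_ne hxi hxj]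
      by_cases hxm : x = m
      · rw [hxm, ham, hbm, ite_self]
      rw [ha' x hxm hxi, hb' x hxm hxj, (hfix x hx hxm).1, (hfix x hx hxm).2, ite_self]
  · rintro ⟨π, σ⟩ - ⟨π', σ'⟩ - h
    simp only [Prod.mk.injEq] at h
    have := switch_injective i (a₁ := (π * swap m i, σ⁻¹ * swap m j))
      (a₂ := (π' * swap m i, σ'⁻¹ * swap m j))
      (Prod.ext h.1 (mul_right_cancel h.2))
    simpa using this

-- By the dichotomy each pair admits one of the two switches, so the squares satisfy Q² ≤ 2P². The
-- factor 2 is a rounding up of √2.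
include hR hs in
theorem ncard_permsThrough_le (hm : m ∉ S) (hiS : i ∈ S) (hjS : j ∈ S) :
    (permsThrough R S m i j).ncard ≤ 2 * (permsIn R S).ncard := by
  have hj : j ≠ m := fun h => hm (h ▸ hjS)
  set Q := permsThrough R S m i j with hQ
  have hQf : Q.Finite := (finite_permsIn R (insert m S)).subset fun π hπ => hπ.1
  have key : Q.ncard ^ 2 ≤ (permsIn R S).ncard ^ 2 + (permsIn R S).ncard ^ 2 := by
    refine le_trans ?_ (add_le_add (ncard_permsThrough_far (m := m) (i := i) (j := j) hR hs)
      (ncard_permsThrough_near (m := m) hs hiS hjS hR))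
    refine le_trans ?_ (Set.ncard_union_le _ _)
    rw [sq, ← Set.ncard_prod]
    refine Set.ncard_le_ncard ?_ ?_
    · rintro ⟨π, σ⟩ ⟨hπ, hσ⟩
      rcases sameCycle_dichotomy hj hπ.2.1 (inv_apply_eq_of hσ.2.2) with h | h
      · exact Or.inl ⟨⟨hπ, hσ⟩, h⟩
      · exact Or.inr ⟨⟨hπ, hσ⟩, h⟩
    · refine (hQf.prod hQf).subset ?_
      rintro p (hp | hp)
      exacts [⟨hp.1.1, hp.1.2⟩, ⟨hp.1.1, hp.1.2⟩]
  nlinarith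

-- Either `m` is fixed, or its predecessor and successor both lie in `N`, which leaves at most |N|²
-- choices.
include hR hs in
theorem ncard_permsIn_insert_le (hm : m ∉ S) {T N : Finset α} (hT : ∀ x, x ∈ T ↔ x = m ∨ x ∈ S)
    (hN : ∀ x, x ∈ N ↔ x ∈ S ∧ R m x) :
    (permsIn R T).ncard ≤ (1 + 2 * N.card ^ 2) * (permsIn R S).ncard := by
  obtain rfl : T = insert m S := by ext x; rw [hT, Finset.mem_insert]
  have hsub : permsIn R (insert m S) ⊆
      permsIn R S ∪ ⋃ p ∈ N ×ˢ N, permsThrough R S m p.1 p.2 := by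
    intro π hπ
    by_cases hπm : π m = m
    · left
      refine ⟨hπ.1, fun x hx => ?_⟩
      by_cases hxm : x = m
      · rw [hxm, hπm]
      · exact hπ.2 x (by simp [hx, hxm])
    · right
      have hmem : ∀ x, x ≠ m → π x ≠ x → x ∈ S := by
        intro x hxm hx
        by_contra h
        exact hx (hπ.2 x (by simp [h, hxm]))
      have hi1 : π (π⁻¹ m) = m := by rw [← Perm.mul_apply, mul_inv_cancel, Perm.one_apply]
      have hi2 : π⁻¹ m ≠ m := fun h => hπm (by rw [h] at hi1; exact hi1)
      simp only [Set.mem_iUnion]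
      refine ⟨(π⁻¹ m, π m), ?_, hπ, hi1, rfl⟩
      simp only [Finset.mem_product, hN]
      refine ⟨⟨hmem _ hi2 (by rw [hi1]; exact hi2.symm), rel_inv_apply hs hπ.1 m⟩,
        hmem _ hπm (fun h => hπm (π.injective h)), hπ.1 m⟩
  have hfin : (permsIn R S ∪ ⋃ p ∈ N ×ˢ N, permsThrough R S m p.1 p.2).Finite := by
    refine (finite_permsIn R S).union (Set.Finite.biUnion (Finset.finite_toSet _) fun p _ => ?_)
    exact (finite_permsIn R (insert m S)).subset fun π hπ => hπ.1
  refine (Set.ncard_le_ncard hsub hfin).trans ((Set.ncard_union_le _ _).trans ?_)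
  have h1 : (⋃ p ∈ N ×ˢ N, permsThrough R S m p.1 p.2).ncard ≤
      ∑ p ∈ N ×ˢ N, (permsThrough R S m p.1 p.2).ncard :=
    Finset.set_ncard_biUnion_le _ _
  have h2 : ∑ p ∈ N ×ˢ N, (permsThrough R S m p.1 p.2).ncard ≤
      ∑ p ∈ N ×ˢ N, 2 * (permsIn R S).ncard := by
    refine Finset.sum_le_sum fun p hp => ?_
    rw [Finset.mem_product, hN, hN] at hp
    exact ncard_permsThrough_le hR hs hm hp.1.1 hp.2.1
  rw [Finset.sum_const, Finset.card_product, smul_eq_mul] at h2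
  nlinarith

end PermsIn

/-! ### Permutation counts on the divisibility graph: components and scaling -/

section Structure

open Equiv Classical

theorem mem_iff_apply_mem_of_mem_permsIn {α : Type*} {R : α → α → Prop} {S : Finset α}
    {π : Perm α} (hπ : π ∈ permsIn R S) (x : α) : π x ∈ S ↔ x ∈ S := by
  constructor
  · intro hx
    by_contra h
    rw [hπ.2 _ h] at hx
    exact h hx
  · intro hx
    by_contra h
    have := hπ.2 _ h
    exact h ((π.injective this).symm ▸ hx)

theorem ncard_permsIn_union {α : Type*} {R : α → α → Prop} (hR : ∀ x, R x x) {T U : Finset α}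
    (hd : Disjoint T U) {V : Finset α} (hV : ∀ x, x ∈ V ↔ x ∈ T ∨ x ∈ U)
    (hTU : ∀ x ∈ T, ∀ y ∈ U, ¬ R x y) (hUT : ∀ x ∈ U, ∀ y ∈ T, ¬ R x y) :
    (permsIn R V).ncard = (permsIn R T).ncard * (permsIn R U).ncard := by
  have hnU : ∀ x ∈ T, x ∉ U := fun x hx => Finset.disjoint_left.1 hd hx
  rw [← Set.ncard_prod, eq_comm]
  have hinj : Set.InjOn (fun p : Perm α × Perm α => p.1 * p.2) (permsIn R T ×ˢ permsIn R U) := by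
    rintro ⟨a, b⟩ ⟨ha, hb⟩ ⟨a', b'⟩ ⟨ha', hb'⟩ h
    simp only at *
    have hbb : b = b' := by
      ext x
      by_cases hx : x ∈ U
      · have := congrArg (fun f : Perm α => f x) h
        simp only [Perm.mul_apply] at this
        rwa [ha.2 _ (fun h => hnU _ h ((mem_iff_apply_mem_of_mem_permsIn hb x).2 hx)),
          ha'.2 _ (fun h => hnU _ h ((mem_iff_apply_mem_of_mem_permsIn hb' x).2 hx))] at this
      · rw [hb.2 x hx, hb'.2 x hx]
    rw [hbb] at h
    exact Prod.ext (mul_right_cancel h) hbb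
  rw [← hinj.ncard_image]
  congr 1
  ext π
  constructor
  · rintro ⟨⟨a, b⟩, ⟨ha, hb⟩, rfl⟩
    simp only at *
    refine ⟨fun x => ?_, fun x hx => ?_⟩
    · rw [Perm.mul_apply]
      by_cases hx : x ∈ U
      · rw [ha.2 _ (fun h => hnU _ h ((mem_iff_apply_mem_of_mem_permsIn hb x).2 hx))]
        exact hb.1 x
      · rw [hb.2 x hx]
        exact ha.1 x
    · rw [hV, not_or] at hx
      rw [Perm.mul_apply, hb.2 x hx.2, ha.2 x hx.1]
  · intro hπ
    have hT : ∀ x, π x ∈ T ↔ x ∈ T := by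
      intro x
      have h1 := mem_iff_apply_mem_of_mem_permsIn hπ x
      have h2 := hπ.1 x
      simp only [hV] at h1
      constructor
      · intro h
        rcases h1.1 (Or.inl h) with h' | h'
        · exact h'
        · exact absurd h2 (hUT _ h' _ h)
      · intro h
        rcases h1.2 (Or.inl h) with h' | h'
        · exact h'
        · exact absurd h2 (hTU _ h _ h')
    set a : Perm α := Perm.ofSubtype (π.subtypePerm (p := (· ∈ T)) hT) with ha
    have ha1 : ∀ x ∈ T, a x = π x := fun x hx => by
      rw [ha, Perm.ofSubtype_apply_of_mem _ hx]; rfl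
    have ha2 : ∀ x, x ∉ T → a x = x := fun x hx => Perm.ofSubtype_apply_of_not_mem _ hx
    have haT : a ∈ permsIn R T := by
      refine ⟨fun x => ?_, ha2⟩
      by_cases hx : x ∈ T
      · rw [ha1 x hx]; exact hπ.1 x
      · rw [ha2 x hx]; exact hR x
    have hb1 : ∀ x, x ∈ T → (a⁻¹ * π) x = x := fun x hx => by
      rw [Perm.mul_apply]; exact inv_apply_eq_of (ha1 x hx)
    have hb2 : ∀ x, x ∉ T → (a⁻¹ * π) x = π x := fun x hx => by
      rw [Perm.mul_apply]; exact inv_apply_eq_of (ha2 _ (fun h => hx ((hT x).1 h)))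
    refine ⟨(a, a⁻¹ * π), ⟨haT, fun x => ?_, fun x hx => ?_⟩, by simp⟩
    · by_cases hx : x ∈ T
      · simp only [hb1 x hx]; exact hR x
      · simp only [hb2 x hx]; exact hπ.1 x
    · by_cases hxT : x ∈ T
      · exact hb1 x hxT
      · simp only [hb2 x hxT]
        exact hπ.2 x (by simp [hV, hx, hxT])

theorem ncard_permsIn_eq_card {α : Type*} {R : α → α → Prop} (hR : ∀ x, R x x) (S : Finset α) :
    (permsIn R S).ncard = Nat.card {π : Perm S // ∀ x : S, R x (π x)} := by
  rw [← Nat.card_coe_set_eq]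
  refine Nat.card_congr (Equiv.trans ?_
    ((Perm.subtypeEquivSubtypePerm (· ∈ S)).subtypeEquiv
      (q := fun f => ∀ x, R x (f.1 x)) fun π => ?_).symm)
  · refine ⟨fun π => ⟨⟨π.1, fun a ha => π.2.2 a ha⟩, π.2.1⟩,
      fun π => ⟨π.1.1, π.2, π.1.2⟩, fun _ => rfl, fun _ => rfl⟩
  · constructor
    · intro h x
      by_cases hx : x ∈ S
      · rw [Perm.subtypeEquivSubtypePerm_apply_of_mem _ hx]; exact h ⟨x, hx⟩
      · rw [Perm.subtypeEquivSubtypePerm_apply_of_not_mem _ hx]; exact hR x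
    · intro h x
      have := h x
      rwa [Perm.subtypeEquivSubtypePerm_apply_of_mem _ x.2] at this

/-- An embedding restricts to an equivalence of a finset with its image. -/
noncomputable def finsetMapEquiv {α β : Type*} (e : α ↪ β) (S : Finset α) : S ≃ S.map e :=
  Equiv.ofBijective (fun x => ⟨e x, Finset.mem_map_of_mem e x.2⟩) ⟨fun x y h =>
    Subtype.ext (e.injective (congrArg Subtype.val h)), fun y => by
      obtain ⟨x, hx, h⟩ := Finset.mem_map.1 y.2
      exact ⟨⟨x, hx⟩, Subtype.ext h⟩⟩

theorem ncard_permsIn_map {α β : Type*} {R : α → α → Prop} {R' : β → β → Prop}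
    (hR : ∀ x, R x x) (hR' : ∀ x, R' x x) (e : α ↪ β) (he : ∀ x y, R' (e x) (e y) ↔ R x y)
    (S : Finset α) : (permsIn R' (S.map e)).ncard = (permsIn R S).ncard := by
  rw [ncard_permsIn_eq_card hR, ncard_permsIn_eq_card hR', eq_comm]
  refine Nat.card_congr ((finsetMapEquiv e S).permCongr.subtypeEquiv fun π => ?_)
  constructor
  · rintro h ⟨x, hx⟩
    obtain ⟨y, hy, rfl⟩ := Finset.mem_map.1 hx
    have := (he _ _).2 (h ⟨y, hy⟩)
    simp only [Equiv.permCongr_apply]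
    convert! this
    have : (finsetMapEquiv e S).symm ⟨e y, hx⟩ = ⟨y, hy⟩ := by
      rw [Equiv.symm_apply_eq]; rfl
    rw [this]; rfl
  · intro h x
    have := h (finsetMapEquiv e S x)
    simp only [Equiv.permCongr_apply, Equiv.symm_apply_apply] at this
    exact (he _ _).1 this

/-- One of `a` and `b` divides the other. -/
def DvdRel (a b : ℕ) : Prop := a ∣ b ∨ b ∣ a

instance : DecidableRel DvdRel := fun a b => inferInstanceAs (Decidable (a ∣ b ∨ b ∣ a))

theorem DvdRel.refl (a : ℕ) : DvdRel a a := Or.inl dvd_rfl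

theorem DvdRel.symm {a b : ℕ} (h : DvdRel a b) : DvdRel b a := Or.symm h

/-- The number of permutations of `S` along which consecutive elements divide one another. -/
noncomputable def coverCount (S : Finset ℕ) : ℕ := (permsIn DvdRel S).ncard

theorem card_Sdiv (n : ℕ) : (Sdiv n).card = coverCount (Finset.Icc 1 n) := by
  rw [coverCount, ncard_permsIn_eq_card DvdRel.refl, Sdiv, ← Fintype.card_subtype,
    ← Nat.card_eq_fintype_card]
  rfl

theorem coverCount_pos (S : Finset ℕ) : 0 < coverCount S := ncard_permsIn_pos DvdRel.refl S

theorem coverCount_empty : coverCount ∅ = 1 := by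
  have : permsIn DvdRel ∅ = {1} := by
    ext π
    refine ⟨fun h => ?_, fun h => ?_⟩
    · ext x; exact h.2 x (by simp)
    · rw [h]; exact one_mem_permsIn DvdRel.refl _
  rw [coverCount, this, Set.ncard_singleton]

theorem coverCount_mono {S T : Finset ℕ} (h : S ⊆ T) : coverCount S ≤ coverCount T :=
  Set.ncard_le_ncard (permsIn_mono h) (finite_permsIn _ _)

theorem coverCount_insert_le {S : Finset ℕ} {m : ℕ} (hm : m ∉ S) :
    coverCount (insert m S) ≤
      (1 + 2 * (S.filter fun x => DvdRel m x).card ^ 2) * coverCount S := by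
  exact ncard_permsIn_insert_le DvdRel.refl (fun _ _ => DvdRel.symm) hm
    (fun _ => Finset.mem_insert) (fun _ => Finset.mem_filter)

theorem coverCount_union {T U : Finset ℕ} (hd : Disjoint T U)
    (h : ∀ x ∈ T, ∀ y ∈ U, ¬ DvdRel x y) :
    coverCount (T ∪ U) = coverCount T * coverCount U :=
  ncard_permsIn_union DvdRel.refl hd (fun _ => Finset.mem_union) h fun x hx y hy hxy => h y hy x hx hxy.symm

theorem coverCount_map_mul {b : ℕ} (hb : 0 < b) (S : Finset ℕ) :
    coverCount (S.map ⟨fun t => b * t, fun _ _ h => Nat.eq_of_mul_eq_mul_left hb h⟩) = coverCount S :=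
  ncard_permsIn_map DvdRel.refl DvdRel.refl _ (fun x y => by
    change (b * x ∣ b * y ∨ b * y ∣ b * x) ↔ _
    rw [Nat.mul_dvd_mul_iff_left hb, Nat.mul_dvd_mul_iff_left hb, DvdRel]) S

theorem coverCount_one_two : coverCount {1, 2} = 2 := by
  have h : ({1, 2} : Finset ℕ) = Finset.Icc 1 2 := by decide
  rw [h, ← card_Sdiv]
  decide

theorem coverCount_singleton (a : ℕ) : coverCount {a} = 1 := by
  apply le_antisymm _ (coverCount_pos _)
  have := coverCount_insert_le (Finset.notMem_empty a)
  rw [coverCount_empty] at this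
  simpa using this

end Structure

/-! ### Brun's sieve -/

section Sieve

theorem card_Ioc_floor_bounds {A B : ℝ} (hA : 0 ≤ A) (hAB : A ≤ B) :
    B - A - 1 ≤ ((Finset.Ioc ⌊A⌋₊ ⌊B⌋₊).card : ℝ) ∧
      ((Finset.Ioc ⌊A⌋₊ ⌊B⌋₊).card : ℝ) ≤ B - A + 1 := by
  rw [Nat.card_Ioc, Nat.cast_sub (Nat.floor_le_floor hAB)]
  have h1 := Nat.floor_le hA
  have h2 := Nat.floor_le (hA.trans hAB)
  have h3 := Nat.lt_floor_add_one A
  have h4 := Nat.lt_floor_add_one B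
  constructor <;> linarith

/-- Division by `p` preserves non-divisibility by the primes of `Q`, as these differ from `p`. This
is the scaling step of the sieve recursion. -/
theorem card_multiples_eq {Q : Finset ℕ} (hQ : ∀ q ∈ Q, q.Prime) {p : ℕ} (hp : p.Prime)
    (hpQ : p ∉ Q) (A B : ℝ) :
    ((Finset.Ioc ⌊A⌋₊ ⌊B⌋₊).filter fun b => (∀ q ∈ Q, ¬ q ∣ b) ∧ p ∣ b).card =
      ((Finset.Ioc ⌊A / p⌋₊ ⌊B / p⌋₊).filter fun b => ∀ q ∈ Q, ¬ q ∣ b).card := by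
  rw [eq_comm]
  have hp0 := hp.pos
  refine Finset.card_bij (fun b _ => p * b) ?_ ?_ ?_
  · intro b hb
    simp only [Finset.mem_filter, Finset.mem_Ioc, Nat.floor_div_natCast] at hb ⊢
    obtain ⟨⟨h1, h2⟩, h3⟩ := hb
    refine ⟨⟨?_, ?_⟩, fun q hq hd => ?_, dvd_mul_right _ _⟩
    · rw [Nat.div_lt_iff_lt_mul hp0] at h1; linarith
    · rw [Nat.le_div_iff_mul_le hp0] at h2; linarith
    · rcases (hQ q hq).dvd_mul.1 hd with h | h
      · rw [(Nat.prime_dvd_prime_iff_eq (hQ q hq) hp).1 h] at hq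
        exact hpQ hq
      · exact h3 q hq h
  · intro a _ b _ h
    exact Nat.eq_of_mul_eq_mul_left hp0 h
  · intro b hb
    simp only [Finset.mem_filter, Finset.mem_Ioc] at hb
    obtain ⟨⟨h1, h2⟩, h3, c, rfl⟩ := hb
    refine ⟨c, ?_, rfl⟩
    simp only [Finset.mem_filter, Finset.mem_Ioc, Nat.floor_div_natCast]
    refine ⟨⟨?_, ?_⟩, fun q hq hd => h3 q hq (hd.mul_left p)⟩
    · rw [Nat.div_lt_iff_lt_mul hp0]; linarith
    · rw [Nat.le_div_iff_mul_le hp0]; linarith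

theorem prod_one_sub_inv_mem {Q : Finset ℕ} (hQ : ∀ q ∈ Q, q.Prime) :
    0 ≤ ∏ p ∈ Q, (1 - 1 / (p : ℝ)) ∧ ∏ p ∈ Q, (1 - 1 / (p : ℝ)) ≤ 1 := by
  have h : ∀ p ∈ Q, 0 ≤ 1 - 1 / (p : ℝ) ∧ 1 - 1 / (p : ℝ) ≤ 1 := by
    intro p hp
    have h1 : (1 : ℝ) ≤ p := by exact_mod_cast (hQ p hp).one_le
    have h2 : 1 / (p : ℝ) ≤ 1 := by rw [div_le_one (by linarith)]; exact h1
    have h3 : 0 ≤ 1 / (p : ℝ) := by positivity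
    constructor <;> linarith
  exact ⟨Finset.prod_nonneg fun p hp => (h p hp).1,
    Finset.prod_le_one (fun p hp => (h p hp).1) fun p hp => (h p hp).2⟩

/-- Brun's sieve in short intervals, with the tail of the inclusion-exclusion weighted by `lam`. -/
theorem abs_card_sifted_sub_le {lam : ℝ} (hlam : 0 < lam) (Q : Finset ℕ) (hQ : ∀ q ∈ Q, q.Prime)
    (r : ℕ) {A B : ℝ} (hA : 0 ≤ A) (hAB : A ≤ B) :
    |(((Finset.Ioc ⌊A⌋₊ ⌊B⌋₊).filter fun b => ∀ q ∈ Q, ¬ q ∣ b).card : ℝ)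
        - (B - A) * ∏ p ∈ Q, (1 - 1 / (p : ℝ))| ≤
      (1 + Q.card : ℝ) ^ r + (B - A) / lam ^ r * ∏ p ∈ Q, (1 + lam / p) := by
  have hprod1 : ∀ Q : Finset ℕ, 1 ≤ ∏ p ∈ Q, (1 + lam / (p : ℝ)) := fun Q =>
    Finset.prod_induction _ (fun x : ℝ => 1 ≤ x) (fun _ _ ha hb => one_le_mul_of_one_le_of_one_le ha hb)
      le_rfl fun p _ => by
        have : 0 ≤ lam / (p : ℝ) := by positivity
        linarith
  -- Sifting by one more prime `p` removes its multiples, which rescale to a sifted interval `p`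
  -- times shorter. The depth `r` drops by one on that branch, a unit of depth being exchanged for a
  -- factor `lam / p`. At depth 0 the trivial bound is enough.
  induction Q using Finset.induction generalizing r A B with
  | empty =>
    have h := card_Ioc_floor_bounds hA hAB
    have h1 : 0 ≤ (B - A) / lam ^ r := div_nonneg (by linarith) (by positivity)
    simp only [Finset.notMem_empty, false_imp_iff, implies_true, Finset.filter_true,
      Finset.prod_empty, Finset.card_empty, Nat.cast_zero, add_zero, one_pow, mul_one]
    rw [abs_le]
    constructor <;> linarith [h.1, h.2]
  | insert p Q hpQ ih =>
    have hQ' : ∀ q ∈ Q, q.Prime := fun q hq => hQ q (Finset.mem_insert_of_mem hq)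
    have hp : p.Prime := hQ p (Finset.mem_insert_self p Q)
    have hp0 : (0 : ℝ) < p := by exact_mod_cast hp.pos
    rcases r with _ | r
    · have h := card_Ioc_floor_bounds hA hAB
      have hc : ((((Finset.Ioc ⌊A⌋₊ ⌊B⌋₊).filter fun b => ∀ q ∈ insert p Q, ¬ q ∣ b).card : ℕ) : ℝ)
          ≤ B - A + 1 := le_trans (by exact_mod_cast Finset.card_filter_le _ _) h.2
      have hw := prod_one_sub_inv_mem hQ
      have h1 : (B - A) * ∏ p ∈ insert p Q, (1 - 1 / (p : ℝ)) ≤ B - A :=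
        mul_le_of_le_one_right (by linarith) hw.2
      have h2 : 0 ≤ (B - A) * ∏ p ∈ insert p Q, (1 - 1 / (p : ℝ)) :=
        mul_nonneg (by linarith) hw.1
      have h3 : B - A ≤ (B - A) * ∏ p ∈ insert p Q, (1 + lam / p) :=
        le_mul_of_one_le_right (by linarith) (hprod1 _)
      have h4 : (0 : ℝ) ≤
        (((Finset.Ioc ⌊A⌋₊ ⌊B⌋₊).filter fun b => ∀ q ∈ insert p Q, ¬ q ∣ b).card : ℕ) :=
        Nat.cast_nonneg _
      rw [pow_zero, pow_zero, div_one, abs_le]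
      constructor <;> linarith
    · have hsplit : (((Finset.Ioc ⌊A⌋₊ ⌊B⌋₊).filter fun b => ∀ q ∈ Q, ¬ q ∣ b).card : ℝ) =
          (((Finset.Ioc ⌊A / p⌋₊ ⌊B / p⌋₊).filter fun b => ∀ q ∈ Q, ¬ q ∣ b).card : ℝ) +
          (((Finset.Ioc ⌊A⌋₊ ⌊B⌋₊).filter fun b => ∀ q ∈ insert p Q, ¬ q ∣ b).card : ℝ) := by
        rw [← card_multiples_eq hQ' hp hpQ, ← Nat.cast_add]
        congr 1
        rw [← Finset.card_filter_add_card_filter_not (p := fun b => p ∣ b)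
          (s := (Finset.Ioc ⌊A⌋₊ ⌊B⌋₊).filter fun b => ∀ q ∈ Q, ¬ q ∣ b),
          Finset.filter_filter, Finset.filter_filter]
        congr 2
        refine Finset.filter_congr fun b _ => ?_
        simp only [Finset.mem_insert, forall_eq_or_imp]
        tauto
      have h1 := ih hQ' (r + 1) hA hAB
      have h2 := ih hQ' r (A := A / p) (B := B / p) (by positivity)
        (div_le_div_of_nonneg_right hAB hp0.le)
      rw [Finset.prod_insert hpQ, Finset.prod_insert hpQ, Finset.card_insert_of_notMem hpQ]
      set N := (((Finset.Ioc ⌊A⌋₊ ⌊B⌋₊).filter fun b => ∀ q ∈ Q, ¬ q ∣ b).card : ℝ)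
      set N' := (((Finset.Ioc ⌊A / p⌋₊ ⌊B / p⌋₊).filter fun b => ∀ q ∈ Q, ¬ q ∣ b).card : ℝ)
      set N'' := (((Finset.Ioc ⌊A⌋₊ ⌊B⌋₊).filter fun b => ∀ q ∈ insert p Q, ¬ q ∣ b).card : ℝ)
      set W := ∏ p ∈ Q, (1 - 1 / (p : ℝ))
      set V := ∏ p ∈ Q, (1 + lam / (p : ℝ))
      have hN : N'' - (B - A) * ((1 - 1 / p) * W) =
          (N - (B - A) * W) - (N' - (B / p - A / p) * W) := by
        rw [hsplit]; field_simp; ring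
      rw [hN]
      refine (abs_sub _ _).trans ((add_le_add h1 h2).trans ?_)
      have e1 : (B / p - A / p) / lam ^ r * V = (B - A) / lam ^ (r + 1) * (lam / p * V) := by
        field_simp; ring
      rw [e1]
      have e2 : (1 + Q.card : ℝ) ^ (r + 1) + (1 + Q.card : ℝ) ^ r ≤
          (1 + ((Q.card + 1 : ℕ) : ℝ)) ^ (r + 1) := by
        have hq : (0 : ℝ) ≤ Q.card := Nat.cast_nonneg _
        have : (1 + Q.card : ℝ) ^ r ≤ (1 + ((Q.card + 1 : ℕ) : ℝ)) ^ r := by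
          apply pow_le_pow_left₀ (by positivity); push_cast; linarith
        rw [pow_succ, pow_succ]
        push_cast at this ⊢
        nlinarith [pow_nonneg (show (0 : ℝ) ≤ 1 + Q.card by positivity) r]
      nlinarith [e2]

end Sieve

/-! ### Smooth and rough parts, Euler products -/

section Smooth

/-- `b` has no prime factor up to `k`. -/
def IsRough (k b : ℕ) : Prop := ∀ p ∈ (k + 1).primesBelow, ¬ p ∣ b

instance (k : ℕ) : DecidablePred (IsRough k) := fun b => by unfold IsRough; infer_instance

theorem exists_smooth_mul_rough (k : ℕ) {m : ℕ} (hm : m ≠ 0) :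
    ∃ s ∈ (k + 1).smoothNumbers, ∃ b, IsRough k b ∧ m = s * b := by
  induction m using induction_on_primes with
  | zero => exact absurd rfl hm
  | one =>
    refine ⟨1, Nat.mem_smoothNumbers.2 ⟨one_ne_zero, by simp⟩, 1, fun p hp h => ?_, rfl⟩
    exact (Nat.prime_of_mem_primesBelow hp).one_lt.ne' (Nat.dvd_one.1 h)
  | prime_mul p a hp ih =>
    obtain ⟨s, hs, b, hb, rfl⟩ := ih (fun h => hm (by rw [h, mul_zero]))
    by_cases hpk : p < k + 1
    · refine ⟨p * s, ?_, b, hb, by ring⟩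
      exact Nat.mul_mem_smoothNumbers (Nat.mem_smoothNumbers_of_lt hp.pos hpk) hs
    · refine ⟨s, hs, p * b, fun q hq h => ?_, by ring⟩
      have hq' := Nat.prime_of_mem_primesBelow hq
      rcases hq'.dvd_mul.1 h with h | h
      · rw [(Nat.prime_dvd_prime_iff_eq hq' hp).1 h] at hq
        exact hpk (Nat.lt_of_mem_primesBelow hq)
      · exact hb q hq h

theorem IsRough.coprime {k b s : ℕ} (hb : IsRough k b) (hs : s ∈ (k + 1).smoothNumbers) :
    s.Coprime b :=
  Nat.coprime_of_dvd fun p hp h1 h2 =>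
    hb p (Nat.mem_primesBelow.2 ⟨Nat.mem_smoothNumbers'.1 hs p hp h1, hp⟩) h2

theorem smooth_mul_rough_unique {k s s' b b' : ℕ} (hs : s ∈ (k + 1).smoothNumbers)
    (hs' : s' ∈ (k + 1).smoothNumbers) (hb : IsRough k b) (hb' : IsRough k b')
    (h : s * b = s' * b') : s = s' ∧ b = b' := by
  have h1 : s ∣ s' := (hb'.coprime hs).dvd_of_dvd_mul_right (h ▸ dvd_mul_right s b)
  have h2 : s' ∣ s := (hb.coprime hs').dvd_of_dvd_mul_right (h ▸ dvd_mul_right s' b')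
  obtain rfl := Nat.dvd_antisymm h1 h2
  exact ⟨rfl, Nat.eq_of_mul_eq_mul_left (Nat.pos_of_ne_zero hs.1) h⟩

/-- The Euler product over primes up to `k` of `∑ s ^ (δ - 1)`. -/
noncomputable def eulerProd (k : ℕ) (δ : ℝ) : ℝ :=
  ∏ p ∈ (k + 1).primesBelow, (1 - (p : ℝ) ^ (δ - 1))⁻¹

theorem prime_rpow_sub_one_lt_one {δ : ℝ} (hδ : δ < 1) {p : ℕ} (hp : p.Prime) :
    (p : ℝ) ^ (δ - 1) < 1 :=
  Real.rpow_lt_one_of_one_lt_of_neg (by exact_mod_cast hp.one_lt) (by linarith)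

theorem hasSum_smooth {δ : ℝ} (hδ : δ < 1) (k : ℕ) :
    HasSum (fun s : (k + 1).smoothNumbers => ((s : ℕ) : ℝ) ^ (δ - 1)) (eulerProd k δ) := by
  let f : ℕ →* ℝ :=
    { toFun := fun n => (n : ℝ) ^ (δ - 1)
      map_one' := by simp
      map_mul' := fun m n => by
        rw [Nat.cast_mul, Real.mul_rpow (Nat.cast_nonneg _) (Nat.cast_nonneg _)] }
  have hf : ∀ {p : ℕ}, p.Prime → ‖f p‖ < 1 := by
    intro p hp
    change ‖(p : ℝ) ^ (δ - 1)‖ < 1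
    rw [Real.norm_of_nonneg (by positivity)]
    exact prime_rpow_sub_one_lt_one hδ hp
  exact (EulerProduct.summable_and_hasSum_smoothNumbers_prod_primesBelow_geometric hf (k + 1)).2

/-- The density of the integers with no prime factor up to `k`. -/
noncomputable def roughDensity (k : ℕ) : ℝ := ∏ p ∈ (k + 1).primesBelow, (1 - 1 / (p : ℝ))

theorem roughDensity_pos (k : ℕ) : 0 < roughDensity k := by
  refine Finset.prod_pos fun p hp => ?_
  have : (1 : ℝ) < p := by exact_mod_cast (Nat.prime_of_mem_primesBelow hp).one_lt
  rw [sub_pos, div_lt_one (by linarith)]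
  exact this

theorem roughDensity_le_one (k : ℕ) : roughDensity k ≤ 1 :=
  (prod_one_sub_inv_mem fun _ hq => Nat.prime_of_mem_primesBelow hq).2

theorem hasSum_smooth_inv (k : ℕ) :
    HasSum (fun s : (k + 1).smoothNumbers => 1 / ((s : ℕ) : ℝ)) (roughDensity k)⁻¹ := by
  have h := hasSum_smooth (δ := 0) (by norm_num) k
  have e : eulerProd k 0 = (roughDensity k)⁻¹ := by
    rw [eulerProd, roughDensity, ← Finset.prod_inv_distrib]
    refine Finset.prod_congr rfl fun p _ => ?_
    rw [zero_sub, Real.rpow_neg_one, one_div]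
  rw [e] at h
  refine h.congr_fun fun s => ?_
  rw [zero_sub, Real.rpow_neg_one, one_div]

/-- Extending the product from primes to all integers 2 ≤ j ≤ k only decreases it, and then it
telescopes to 1/k. -/
theorem inv_roughDensity_le {k : ℕ} (hk : 1 ≤ k) : (roughDensity k)⁻¹ ≤ k := by
  have h : 1 / (k : ℝ) ≤ roughDensity k := by
    unfold roughDensity
    induction k, hk using Nat.le_induction with
    | base =>
      have : Nat.primesBelow (1 + 1) = ∅ := by decide
      simp [this]
    | succ k hk ih =>
      have hk0 : (0 : ℝ) < k := by exact_mod_cast hk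
      rw [Nat.primesBelow_succ]
      split_ifs with hp
      · rw [Finset.prod_insert (by simp [Nat.primesBelow])]
        have e : 1 / ((k + 1 : ℕ) : ℝ) = (1 - 1 / ((k + 1 : ℕ) : ℝ)) * (1 / k) := by
          push_cast; field_simp; ring
        refine e.le.trans ?_
        apply mul_le_mul_of_nonneg_left ih
        rw [sub_nonneg, div_le_one (by positivity)]
        push_cast; linarith
      · refine le_trans ?_ ih
        apply one_div_le_one_div_of_le hk0
        push_cast; linarith
  rw [inv_le_comm₀ (roughDensity_pos k) (by exact_mod_cast hk)]
  rwa [one_div] at h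

end Smooth

/-! ### Locality and size of the gain -/

section Gain

/-- The `k`-smooth integers in `[a, z]`. -/
def smoothIcc (k a z : ℕ) : Finset ℕ := (Finset.Icc a z).filter fun t => t ∈ (k + 1).smoothNumbers

theorem mem_smoothIcc {k a z t : ℕ} :
    t ∈ smoothIcc k a z ↔ (a ≤ t ∧ t ≤ z) ∧ t ∈ (k + 1).smoothNumbers := by
  rw [smoothIcc, Finset.mem_filter, Finset.mem_Icc]

/-- The logarithmic gain in the number of covers when `s` is adjoined to the `k`-smooth integers
in `(s, z]`. -/
noncomputable def smoothGain (k s z : ℕ) : ℝ :=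
  Real.log (coverCount (smoothIcc k s z)) - Real.log (coverCount (smoothIcc k (s + 1) z))

/-- The logarithmic gain in the number of covers when `m` is adjoined to `(m, n]`. -/
noncomputable def gain (n m : ℕ) : ℝ :=
  Real.log (coverCount (Finset.Icc m n)) - Real.log (coverCount (Finset.Icc (m + 1) n))

/-- An upper bound for the logarithmic gain of a vertex all of whose neighbours are multiples of it
by at most `k`. -/
noncomputable def gainBound (k : ℕ) : ℝ := Real.log (1 + 2 * ((k : ℝ) - 1) ^ 2)

theorem gainBound_nonneg (k : ℕ) : 0 ≤ gainBound k :=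
  Real.log_nonneg (by nlinarith [sq_nonneg ((k : ℝ) - 1)])

theorem smoothGain_nonneg (k s z : ℕ) : 0 ≤ smoothGain k s z := by
  rw [smoothGain, sub_nonneg]
  apply Real.log_le_log (by exact_mod_cast coverCount_pos _)
  refine Nat.cast_le.2 (coverCount_mono fun t ht => ?_)
  rw [mem_smoothIcc] at ht ⊢
  exact ⟨⟨by omega, ht.1.2⟩, ht.2⟩

/-- In (s, z] the neighbours of `s` are among 2s, …, ks, so the insertion bound applies with at most
k - 1 neighbours. -/
theorem smoothGain_le {k s z : ℕ} (hk : 1 ≤ k) (hs : s ∈ (k + 1).smoothNumbers)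
    (hz : z / s = k) : smoothGain k s z ≤ gainBound k := by
  have hs0 : 0 < s := Nat.pos_of_ne_zero hs.1
  have hsz : s ≤ z := by
    by_contra h
    rw [Nat.div_eq_of_lt (by omega)] at hz
    omega
  have hins : smoothIcc k s z = insert s (smoothIcc k (s + 1) z) := by
    ext t
    simp only [Finset.mem_insert, mem_smoothIcc]
    constructor
    · rintro ⟨⟨h1, h2⟩, h3⟩
      rcases eq_or_lt_of_le h1 with h | h
      · exact Or.inl h.symm
      · exact Or.inr ⟨⟨h, h2⟩, h3⟩
    · rintro (rfl | ⟨⟨h1, h2⟩, h3⟩)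
      · exact ⟨⟨le_refl _, hsz⟩, hs⟩
      · exact ⟨⟨by omega, h2⟩, h3⟩
  have hnot : s ∉ smoothIcc k (s + 1) z := by
    rw [mem_smoothIcc]; omega
  have hcard : ((smoothIcc k (s + 1) z).filter fun x => DvdRel s x).card ≤ k - 1 := by
    have : (Finset.Icc 2 k).card = k - 1 := by rw [Nat.card_Icc]; omega
    rw [← this]
    apply Finset.card_le_card_of_injOn (fun x => x / s)
    · intro x hx
      rw [Finset.mem_coe, Finset.mem_filter, mem_smoothIcc] at hx
      obtain ⟨⟨⟨h1, h2⟩, -⟩, h3⟩ := hx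
      have hd : s ∣ x := by
        rcases h3 with h | h
        · exact h
        · exact absurd (Nat.le_of_dvd hs0 h) (by omega)
      obtain ⟨q, rfl⟩ := hd
      simp only [Finset.coe_Icc, Set.mem_Icc, Nat.mul_div_cancel_left q hs0]
      refine ⟨?_, ?_⟩
      · by_contra h
        have : q ≤ 1 := by omega
        nlinarith
      · rw [← hz, Nat.le_div_iff_mul_le hs0]; linarith
    · intro x hx y hy hxy
      rw [Finset.mem_coe, Finset.mem_filter, mem_smoothIcc] at hx hy
      have hd : ∀ w, s + 1 ≤ w → DvdRel s w → s ∣ w := by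
        intro w hw h
        rcases h with h | h
        · exact h
        · exact absurd (Nat.le_of_dvd hs0 h) (by omega)
      exact (Nat.div_left_inj (hd x hx.1.1.1 hx.2) (hd y hy.1.1.1 hy.2)).1 hxy
  have h := coverCount_insert_le hnot
  rw [← hins] at h
  have hpos : (0 : ℝ) < coverCount (smoothIcc k (s + 1) z) := by exact_mod_cast coverCount_pos _
  rw [smoothGain, gainBound, sub_le_iff_le_add,
    ← Real.log_mul (by nlinarith [sq_nonneg ((k : ℝ) - 1)]) hpos.ne']
  apply Real.log_le_log (by exact_mod_cast coverCount_pos _)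
  refine le_trans (Nat.cast_le.2 h) ?_
  push_cast
  gcongr
  have : (((smoothIcc k (s + 1) z).filter fun x => DvdRel s x).card : ℝ) ≤ ((k - 1 : ℕ) : ℝ) := by
    exact_mod_cast hcard
  rwa [Nat.cast_sub hk, Nat.cast_one] at this

/-- Related elements of [sb, n] have quotient q ≤ k, so q is k-smooth and coprime to `b`. Hence
every neighbour of b·t with t smooth is again b times a smooth number, and no edge joins `T s` to
its complement `U`. The factor `coverCount U` occurs with and without s·b and cancels. -/
theorem gain_eq_smoothGain {n k s b : ℕ} (hk : 1 ≤ k) (hs : s ∈ (k + 1).smoothNumbers)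
    (hb : IsRough k b) (hn : n / (s * b) = k) : gain n (s * b) = smoothGain k s (n / b) := by
  have hs0 : 0 < s := Nat.pos_of_ne_zero hs.1
  have hb0 : 0 < b := by
    rcases Nat.eq_zero_or_pos b with h | h
    · rw [h, mul_zero, Nat.div_zero] at hn; omega
    · exact h
  have hm0 : 0 < s * b := Nat.mul_pos hs0 hb0
  have hkm : ∀ q, q * (s * b) ≤ n → q ≤ k := fun q hq => by
    rw [← hn, Nat.le_div_iff_mul_le hm0]; exact hq
  have hsz : s ≤ n / b := by
    rw [Nat.le_div_iff_mul_le hb0]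
    have : 1 ≤ n / (s * b) := by omega
    rw [Nat.le_div_iff_mul_le hm0] at this
    omega
  set e : ℕ ↪ ℕ := ⟨fun t => b * t, fun _ _ h => Nat.eq_of_mul_eq_mul_left hb0 h⟩ with he
  set T : ℕ → Finset ℕ := fun a => (smoothIcc k a (n / b)).map e with hT
  have hmemT : ∀ a x, x ∈ T a ↔ ∃ t, ((a ≤ t ∧ b * t ≤ n) ∧ t ∈ (k + 1).smoothNumbers) ∧
      b * t = x := by
    intro a x
    simp only [hT, Finset.mem_map, mem_smoothIcc]
    refine exists_congr fun t => ?_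
    rw [Nat.le_div_iff_mul_le hb0, mul_comm t b]
    rfl
  set U : Finset ℕ := Finset.Icc (s * b) n \ T s with hU
  have hmemU : ∀ x, x ∈ U ↔ (s * b ≤ x ∧ x ≤ n) ∧ x ∉ T s := fun x => by
    rw [hU, Finset.mem_sdiff, Finset.mem_Icc]
  have hTsub : ∀ a, s ≤ a → T a ⊆ T s := by
    intro a ha x hx
    rw [hmemT] at hx ⊢
    obtain ⟨t, ⟨⟨h1, h2⟩, h3⟩, h4⟩ := hx
    exact ⟨t, ⟨⟨ha.trans h1, h2⟩, h3⟩, h4⟩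
  have hedge : ∀ x ∈ T s, ∀ y ∈ U, ¬ DvdRel x y := by
    intro x hx y hy hxy
    obtain ⟨t, ⟨⟨h1, h2⟩, h3⟩, rfl⟩ := (hmemT s x).1 hx
    obtain ⟨⟨h4, h5⟩, h6⟩ := (hmemU y).1 hy
    apply h6
    rw [hmemT]
    have hsmall : ∀ q, 0 < q → q ≤ k → q ∈ (k + 1).smoothNumbers := fun q h0 hq =>
      Nat.mem_smoothNumbers_of_lt h0 (by omega)
    rcases hxy with ⟨q, rfl⟩ | ⟨q, hq⟩
    · have hq0 : 0 < q := by
        rcases Nat.eq_zero_or_pos q with h | h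
        · rw [h] at h4; omega
        · exact h
      have hqk : q ≤ k := hkm q (by nlinarith [Nat.mul_le_mul_left (q * b) h1])
      refine ⟨t * q, ⟨⟨by nlinarith, by rw [← mul_assoc]; exact h5⟩,
        Nat.mul_mem_smoothNumbers h3 (hsmall q hq0 hqk)⟩, by ring⟩
    · have hq0 : 0 < q := by
        rcases Nat.eq_zero_or_pos q with h | h
        · rw [h, mul_zero] at hq
          have := Nat.mul_pos hb0 (Nat.pos_of_ne_zero h3.1)
          omega
        · exact h
      have hqk : q ≤ k := hkm q (by nlinarith [Nat.mul_le_mul_left q h4])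
      have hqt : q ∣ t := by
        refine (hb.coprime (hsmall q hq0 hqk)).dvd_of_dvd_mul_left (m := b) ?_
        rw [hq]; exact dvd_mul_left q y
      obtain ⟨t', rfl⟩ := hqt
      have hy : y = b * t' := by
        have : q * y = q * (b * t') := by rw [mul_comm q y, ← hq]; ring
        exact Nat.eq_of_mul_eq_mul_left hq0 this
      refine ⟨t', ⟨⟨?_, by rw [← hy]; exact h5⟩,
        Nat.mem_smoothNumbers_of_dvd h3 (dvd_mul_left t' q)⟩, hy.symm⟩
      rw [hy, mul_comm s b] at h4
      exact Nat.le_of_mul_le_mul_left h4 hb0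
  have hmT : s * b ∈ T s := (hmemT _ _).2 ⟨s, ⟨⟨le_refl _, by
    have := (Nat.le_div_iff_mul_le hb0).1 hsz; linarith⟩, hs⟩, mul_comm _ _⟩
  have hd : Disjoint (T s) U := Finset.disjoint_sdiff
  have e1 : Finset.Icc (s * b) n = T s ∪ U := by
    rw [hU, Finset.union_sdiff_of_subset]
    intro x hx
    obtain ⟨t, ⟨⟨h1, h2⟩, h3⟩, rfl⟩ := (hmemT s x).1 hx
    rw [Finset.mem_Icc]
    exact ⟨by nlinarith, h2⟩
  have e2 : Finset.Icc (s * b + 1) n = T (s + 1) ∪ U := by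
    ext x
    rw [Finset.mem_Icc, Finset.mem_union]
    constructor
    · rintro ⟨h1, h2⟩
      by_cases hx : x ∈ T s
      · left
        obtain ⟨t, ⟨⟨h3, h4⟩, h5⟩, rfl⟩ := (hmemT s x).1 hx
        refine (hmemT _ _).2 ⟨t, ⟨⟨?_, h4⟩, h5⟩, rfl⟩
        rcases eq_or_lt_of_le h3 with h | h
        · rw [← h, mul_comm b s] at h1; omega
        · exact h
      · right
        exact (hmemU x).2 ⟨⟨by omega, h2⟩, hx⟩
    · rintro (hx | hx)
      · obtain ⟨t, ⟨⟨h3, h4⟩, h5⟩, rfl⟩ := (hmemT _ x).1 hx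
        exact ⟨by nlinarith, h4⟩
      · obtain ⟨⟨h1, h2⟩, h3⟩ := (hmemU x).1 hx
        refine ⟨?_, h2⟩
        rcases eq_or_lt_of_le h1 with h | h
        · rw [h] at hmT; exact absurd hmT h3
        · exact h
  have c1 : coverCount (Finset.Icc (s * b) n) =
      coverCount (smoothIcc k s (n / b)) * coverCount U := by
    rw [e1, coverCount_union hd hedge, hT, he, coverCount_map_mul hb0]
  have c2 : coverCount (Finset.Icc (s * b + 1) n) =
      coverCount (smoothIcc k (s + 1) (n / b)) * coverCount U := by
    have hsub := hTsub (s + 1) (Nat.le_succ s)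
    rw [e2, coverCount_union (Finset.disjoint_of_subset_left hsub hd)
      (fun x hx => hedge x (hsub hx)), hT, he, coverCount_map_mul hb0]
  have hpos : ∀ S, (coverCount S : ℝ) ≠ 0 := fun S => by exact_mod_cast (coverCount_pos S).ne'
  rw [gain, smoothGain, c1, c2, Nat.cast_mul, Nat.cast_mul, Real.log_mul (hpos _) (hpos _),
    Real.log_mul (hpos _) (hpos _)]
  ring

theorem log_coverCount_Icc (n : ℕ) :
    Real.log (coverCount (Finset.Icc 1 n)) = ∑ m ∈ Finset.Icc 1 n, gain n m := by
  have h : ∀ j ≤ n, Real.log (coverCount (Finset.Icc (n - j + 1) n)) =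
      ∑ m ∈ Finset.Icc (n - j + 1) n, gain n m := by
    intro j
    induction j with
    | zero => simp [coverCount_empty]
    | succ j ih =>
      intro hj
      have e : n - (j + 1) + 1 + 1 = n - j + 1 := by omega
      rw [← Finset.sum_Ioc_add_eq_sum_Icc (by omega), ← Finset.Icc_add_one_left_eq_Ioc, e,
        ← ih (by omega), gain, e]
      ring
  have := h n le_rfl
  rwa [Nat.sub_self, zero_add] at this

end Gain

/-! ### Layers of constant ⌊n/m⌋ and their densities -/

section Layers

/-- The `k`-smooth part of `m`. -/
noncomputable def smoothPart (k m : ℕ) : ℕ :=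
  if h : m ≠ 0 then (exists_smooth_mul_rough k h).choose else 1

/-- The part of `m` without prime factors up to `k`. -/
noncomputable def roughPart (k m : ℕ) : ℕ := m / smoothPart k m

theorem smoothPart_mem {k m : ℕ} (hm : m ≠ 0) : smoothPart k m ∈ (k + 1).smoothNumbers := by
  rw [smoothPart, dif_pos hm]
  exact (exists_smooth_mul_rough k hm).choose_spec.1

theorem smoothPart_mul_roughPart {k m : ℕ} (hm : m ≠ 0) :
    IsRough k (roughPart k m) ∧ smoothPart k m * roughPart k m = m := by
  have h : ∃ b, IsRough k b ∧ m = smoothPart k m * b := by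
    rw [smoothPart, dif_pos hm]
    exact (exists_smooth_mul_rough k hm).choose_spec.2
  obtain ⟨b, hb, h⟩ := h
  have hs := Nat.pos_of_ne_zero (smoothPart_mem (k := k) hm).1
  have : roughPart k m = b := by
    rw [roughPart]
    exact Nat.div_eq_of_eq_mul_right hs h
  rw [this]
  exact ⟨hb, h.symm⟩

theorem smoothPart_mul {k s b : ℕ} (hs : s ∈ (k + 1).smoothNumbers) (hb : IsRough k b)
    (h : s * b ≠ 0) : smoothPart k (s * b) = s ∧ roughPart k (s * b) = b :=
  smooth_mul_rough_unique (smoothPart_mem h) hs (smoothPart_mul_roughPart h).1 hb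
    (smoothPart_mul_roughPart h).2

/-- The number of integers `b` without prime factors up to `k` and with `⌊n / b⌋ = z`. -/
def roughCount (n k z : ℕ) : ℕ := ((Finset.Icc 1 n).filter fun b => IsRough k b ∧ n / b = z).card

/-- The integers `m` with `⌊n / m⌋ = k`. -/
def layer (n k : ℕ) : Finset ℕ := (Finset.Icc 1 n).filter fun m => n / m = k

theorem div_mul_eq_iff {n s b k : ℕ} (hs : 0 < s) :
    n / (s * b) = k ↔ n / b ∈ Finset.Ico (k * s) (k * s + s) := by
  rw [mul_comm s b, ← Nat.div_div_eq_div_mul, Nat.div_eq_iff hs, Finset.mem_Ico]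
  omega

/-- For m = s·b the condition ⌊n/m⌋ = k says exactly that z = ⌊n/b⌋ lies in [ks, ks + s). -/
theorem sum_layer_eq {n k : ℕ} (hk : 1 ≤ k) (g : ℕ → ℕ → ℝ) {F : Finset ℕ}
    (hF : ∀ s ∈ F, s ∈ (k + 1).smoothNumbers) :
    ∑ m ∈ (layer n k).filter (fun m => smoothPart k m ∈ F), g (smoothPart k m) (n / roughPart k m) =
      ∑ s ∈ F, ∑ z ∈ Finset.Ico (k * s) (k * s + s), g s z * roughCount n k z := by
  rw [← Finset.sum_fiberwise_of_maps_to (t := F) (g := fun m => smoothPart k m)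
    (fun m hm => (Finset.mem_filter.1 hm).2)]
  refine Finset.sum_congr rfl fun s hs => ?_
  have hs' := hF s hs
  have hs0 : 0 < s := Nat.pos_of_ne_zero hs'.1
  have e1 : ∀ z ∈ Finset.Ico (k * s) (k * s + s), g s z * roughCount n k z =
      ∑ b ∈ (Finset.Icc 1 n).filter (fun b => IsRough k b ∧ n / b ∈ Finset.Ico (k * s) (k * s + s))
        with n / b = z, g s (n / b) := by
    intro z hz
    rw [roughCount, mul_comm, ← nsmul_eq_mul, ← Finset.sum_const, Finset.filter_filter]
    refine Finset.sum_congr ?_ fun b hb => ?_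
    · refine Finset.filter_congr fun b _ => ?_
      constructor
      · rintro ⟨h1, rfl⟩; exact ⟨⟨h1, hz⟩, rfl⟩
      · rintro ⟨⟨h1, -⟩, h2⟩; exact ⟨h1, h2⟩
    · rw [(Finset.mem_filter.1 hb).2.2]
  rw [Finset.sum_congr rfl e1, Finset.sum_fiberwise_of_maps_to
    (fun b hb => (Finset.mem_filter.1 hb).2.2)]
  rw [eq_comm]
  refine Finset.sum_bij (fun b _ => s * b) ?_ ?_ ?_ ?_
  · intro b hb
    simp only [Finset.mem_filter, layer, Finset.mem_Icc] at hb ⊢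
    obtain ⟨⟨h1, h2⟩, h3, h4⟩ := hb
    rw [← div_mul_eq_iff hs0] at h4
    have hpos : 0 < s * b := Nat.mul_pos hs0 h1
    have hsp := smoothPart_mul hs' h3 hpos.ne'
    rw [hsp.1]
    refine ⟨⟨⟨⟨hpos, ?_⟩, h4⟩, hs⟩, rfl⟩
    by_contra h
    rw [Nat.div_eq_of_lt (by omega)] at h4
    omega
  · intro a _ b _ h
    exact Nat.eq_of_mul_eq_mul_left hs0 h
  · intro m hm
    simp only [Finset.mem_filter, layer, Finset.mem_Icc] at hm
    obtain ⟨⟨⟨⟨h1, h2⟩, h3⟩, -⟩, rfl⟩ := hm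
    have hm0 : m ≠ 0 := by omega
    obtain ⟨h4, h5⟩ := smoothPart_mul_roughPart (k := k) hm0
    refine ⟨roughPart k m, ?_, h5⟩
    rw [Finset.mem_filter, Finset.mem_Icc, ← div_mul_eq_iff hs0, h5]
    refine ⟨⟨?_, ?_⟩, h4, h3⟩
    · rw [Nat.one_le_iff_ne_zero]
      intro h
      rw [h, mul_zero] at h5
      exact hm0 h5.symm
    · exact (Nat.le_mul_of_pos_left _ hs0).trans (h5.le.trans h2)
  · intro b hb
    simp only [Finset.mem_filter, Finset.mem_Icc] at hb
    have hsp := smoothPart_mul hs' hb.2.1 (Nat.mul_pos hs0 hb.1.1).ne'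
    rw [hsp.1, hsp.2]

theorem gain_eq_of_mem_layer {n k m : ℕ} (hk : 1 ≤ k) (hm : m ∈ layer n k) :
    gain n m = smoothGain k (smoothPart k m) (n / roughPart k m) := by
  rw [layer, Finset.mem_filter, Finset.mem_Icc] at hm
  have hm0 : m ≠ 0 := by omega
  obtain ⟨h4, h5⟩ := smoothPart_mul_roughPart (k := k) hm0
  have := gain_eq_smoothGain (n := n) hk (smoothPart_mem hm0) h4 (by rw [h5]; exact hm.2)
  rwa [h5] at this

theorem gain_mem_Icc_of_mem_layer {n k m : ℕ} (hk : 1 ≤ k) (hm : m ∈ layer n k) :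
    0 ≤ gain n m ∧ gain n m ≤ gainBound k := by
  rw [gain_eq_of_mem_layer hk hm]
  refine ⟨smoothGain_nonneg _ _ _, ?_⟩
  rw [layer, Finset.mem_filter, Finset.mem_Icc] at hm
  have hm0 : m ≠ 0 := by omega
  obtain ⟨h4, h5⟩ := smoothPart_mul_roughPart (k := k) hm0
  apply smoothGain_le hk (smoothPart_mem hm0)
  rw [Nat.div_div_eq_div_mul, mul_comm, h5, hm.2]

theorem card_primesBelow_succ_le {k : ℕ} (hk : 1 ≤ k) :
    (1 + (k + 1).primesBelow.card : ℝ) ≤ k := by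
  have : (k + 1).primesBelow.card ≤ k - 1 := by
    have h : (Finset.Icc 2 k).card = k - 1 := by rw [Nat.card_Icc]; omega
    rw [← h]
    refine Finset.card_le_card fun p hp => ?_
    rw [Nat.mem_primesBelow] at hp
    rw [Finset.mem_Icc]
    exact ⟨hp.2.two_le, by omega⟩
  have h2 : 1 + (k + 1).primesBelow.card ≤ k := by omega
  exact_mod_cast h2

/-- The condition ⌊n/b⌋ = z places b in (n/(z+1), n/z], an interval of length n/(z(z+1)) to which
the sieve applies. -/
theorem abs_roughCount_sub_le {lam : ℝ} (hlam : 0 < lam) {n k z : ℕ} (hk : 1 ≤ k) (hz : 1 ≤ z)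
    (r : ℕ) :
    |(roughCount n k z : ℝ) - n * roughDensity k * (1 / (z * (z + 1)))| ≤
      (k : ℝ) ^ r + n * (1 / (z * (z + 1))) / lam ^ r *
        ∏ p ∈ (k + 1).primesBelow, (1 + lam / p) := by
  have hz0 : (0 : ℝ) < z := by exact_mod_cast hz
  have hn0 : (0 : ℝ) ≤ n := Nat.cast_nonneg n
  have hAB : (n : ℝ) / (z + 1 : ℕ) ≤ n / z := by
    apply div_le_div_of_nonneg_left hn0 hz0; push_cast; linarith
  have h := abs_card_sifted_sub_le hlam (k + 1).primesBelow
    (fun q hq => Nat.prime_of_mem_primesBelow hq) r (by positivity) hAB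
  have hlen : (n : ℝ) / z - n / (z + 1 : ℕ) = n * (1 / (z * (z + 1))) := by
    push_cast; field_simp; ring
  have hcard : ((Finset.Ioc ⌊(n : ℝ) / (z + 1 : ℕ)⌋₊ ⌊(n : ℝ) / z⌋₊).filter
      (IsRough k)).card = roughCount n k z := by
    rw [roughCount, Nat.floor_div_natCast, Nat.floor_div_natCast, Nat.floor_natCast]
    congr 1
    ext b
    simp only [Finset.mem_filter, Finset.mem_Ioc, Finset.mem_Icc]
    rw [Nat.div_lt_iff_lt_mul (by omega : 0 < z + 1), Nat.le_div_iff_mul_le hz]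
    constructor
    · rintro ⟨⟨h1, h2⟩, h3⟩
      have hb : 0 < b := by
        rcases Nat.eq_zero_or_pos b with h | h
        · rw [h, zero_mul] at h1; omega
        · exact h
      refine ⟨⟨hb, by nlinarith⟩, h3, ?_⟩
      rw [Nat.div_eq_iff hb]
      constructor
      · linarith
      · have : n < b * z + b := by linarith
        rw [mul_comm z b]; omega
    · rintro ⟨⟨h1, h2⟩, h3, h4⟩
      rw [Nat.div_eq_iff (by omega)] at h4
      refine ⟨⟨?_, by linarith [h4.1]⟩, h3⟩
      have := h4.2
      rw [mul_comm z b] at this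
      have h5 : b * (z + 1) = b * z + b := by ring
      omega
  rw [mul_right_comm, ← hcard, ← hlen]
  refine le_trans h (add_le_add ?_ le_rfl)
  exact pow_le_pow_left₀ (by positivity) (card_primesBelow_succ_le hk) r

theorem sum_Ico_inv_mul_succ {a b : ℕ} (ha : 1 ≤ a) (hab : a ≤ b) :
    ∑ z ∈ Finset.Ico a b, 1 / ((z : ℝ) * (z + 1)) = 1 / a - 1 / b := by
  induction b, hab using Nat.le_induction with
  | base => simp
  | succ b hb ih =>
    have : (0 : ℝ) < b := by exact_mod_cast (by omega : 0 < b)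
    rw [Finset.sum_Ico_succ_top hb, ih]
    push_cast
    field_simp
    ring

theorem sum_Ico_mul {k s : ℕ} (hk : 1 ≤ k) (hs : 1 ≤ s) :
    ∑ z ∈ Finset.Ico (k * s) (k * s + s), 1 / ((z : ℝ) * (z + 1)) =
      1 / (k * (k + 1)) * (1 / s) := by
  have hk0 : (0 : ℝ) < k := by exact_mod_cast hk
  have hs0 : (0 : ℝ) < s := by exact_mod_cast hs
  rw [sum_Ico_inv_mul_succ (Nat.mul_pos hk hs) (Nat.le_add_right _ _)]
  push_cast
  have : (k : ℝ) * s + s ≠ 0 := by positivity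
  field_simp
  ring

/-- The contribution of the smooth part `s` to the density of the layer `k`, before sieving. -/
noncomputable def smoothWeight (k s : ℕ) : ℝ :=
  ∑ z ∈ Finset.Ico (k * s) (k * s + s), smoothGain k s z * (1 / ((z : ℝ) * (z + 1)))

theorem smoothWeight_mem {k s : ℕ} (hk : 1 ≤ k) (hs : s ∈ (k + 1).smoothNumbers) :
    0 ≤ smoothWeight k s ∧
      smoothWeight k s ≤ gainBound k * (1 / (k * (k + 1))) * (1 / s) := by
  have hs0 : 0 < s := Nat.pos_of_ne_zero hs.1
  constructor
  · exact Finset.sum_nonneg fun z _ => mul_nonneg (smoothGain_nonneg _ _ _) (by positivity)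
  · rw [mul_assoc, ← sum_Ico_mul hk hs0, Finset.mul_sum]
    refine Finset.sum_le_sum fun z hz => ?_
    apply mul_le_mul_of_nonneg_right _ (by positivity)
    apply smoothGain_le hk hs
    rw [Nat.div_eq_iff hs0]
    rw [Finset.mem_Ico] at hz
    omega

/-- The limiting contribution of the layer `k`. -/
noncomputable def layerDensity (k : ℕ) : ℝ :=
  roughDensity k * ∑' s : (k + 1).smoothNumbers, smoothWeight k s

theorem summable_smoothWeight {k : ℕ} (hk : 1 ≤ k) :
    Summable fun s : (k + 1).smoothNumbers => smoothWeight k s :=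
  Summable.of_nonneg_of_le (fun s => (smoothWeight_mem hk s.2).1)
    (fun s => (smoothWeight_mem hk s.2).2) ((hasSum_smooth_inv k).summable.mul_left _)

theorem layerDensity_nonneg {k : ℕ} (hk : 1 ≤ k) : 0 ≤ layerDensity k :=
  mul_nonneg (roughDensity_pos k).le (tsum_nonneg fun s => (smoothWeight_mem hk s.2).1)

theorem hasSum_subtype_of_finset {S : Set ℕ} {F : Finset ℕ} (hF : ∀ s ∈ F, s ∈ S) (f : ℕ → ℝ) :
    HasSum (fun s : S => if (s : ℕ) ∈ F then f s else 0) (∑ s ∈ F, f s) := by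
  classical
  have h : HasSum (fun s : S => if (s : ℕ) ∈ F then f s else 0)
      (∑ s ∈ F.subtype (· ∈ S), if (s : ℕ) ∈ F then f s else 0) :=
    hasSum_sum_of_ne_finset_zero fun s hs => by rw [if_neg]; simpa using hs
  convert! h using 1
  rw [Finset.sum_congr rfl (g := fun s : S => f s)
    (fun s hs => if_pos (by simpa using hs))]
  exact (Finset.sum_subtype_of_mem f hF).symm

theorem tsum_smoothWeight_sub_mem {k : ℕ} (hk : 1 ≤ k) {F : Finset ℕ}
    (hF : ∀ s ∈ F, s ∈ (k + 1).smoothNumbers) :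
    0 ≤ (∑' s : (k + 1).smoothNumbers, smoothWeight k s) - ∑ s ∈ F, smoothWeight k s ∧
      (∑' s : (k + 1).smoothNumbers, smoothWeight k s) - ∑ s ∈ F, smoothWeight k s ≤
        gainBound k * (1 / (k * (k + 1))) * ((roughDensity k)⁻¹ - ∑ s ∈ F, 1 / (s : ℝ)) := by
  have h1 := (summable_smoothWeight hk).hasSum.sub (hasSum_subtype_of_finset hF (smoothWeight k))
  have h2 := ((hasSum_smooth_inv k).sub
    (hasSum_subtype_of_finset hF fun s => 1 / (s : ℝ))).mul_left
      (gainBound k * (1 / (k * (k + 1))))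
  constructor
  · refine h1.nonneg fun s => ?_
    have := (smoothWeight_mem hk s.2).1
    split_ifs
    · simp
    · simpa using this
  · refine hasSum_le (fun s => ?_) h1 h2
    have := (smoothWeight_mem hk s.2).2
    split_ifs
    · simp
    · simpa using this

theorem layerDensity_le {k : ℕ} (hk : 1 ≤ k) :
    layerDensity k ≤ gainBound k * (1 / (k * (k + 1))) := by
  have h := (tsum_smoothWeight_sub_mem hk (F := ∅) (by simp)).2
  simp only [Finset.sum_empty, sub_zero] at h
  have hw := roughDensity_pos k
  calc layerDensity k ≤ roughDensity k * (gainBound k * (1 / (k * (k + 1))) * (roughDensity k)⁻¹) :=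
        mul_le_mul_of_nonneg_left h hw.le
    _ = gainBound k * (1 / (k * (k + 1))) := by field_simp

theorem card_layer_bounds {n k : ℕ} (hk : 1 ≤ k) :
    |((layer n k).card : ℝ) - n * (1 / (k * (k + 1)))| ≤ 1 := by
  have hk0 : (0 : ℝ) < k := by exact_mod_cast hk
  have hn0 : (0 : ℝ) ≤ n := Nat.cast_nonneg n
  have hAB : (n : ℝ) / (k + 1 : ℕ) ≤ n / k := by
    apply div_le_div_of_nonneg_left hn0 hk0; push_cast; linarith
  have h := card_Ioc_floor_bounds (A := (n : ℝ) / (k + 1 : ℕ)) (by positivity) hAB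
  have hlen : (n : ℝ) / k - n / (k + 1 : ℕ) = n * (1 / (k * (k + 1))) := by
    push_cast; field_simp; ring
  have hcard : Finset.Ioc ⌊(n : ℝ) / (k + 1 : ℕ)⌋₊ ⌊(n : ℝ) / k⌋₊ = layer n k := by
    rw [layer, Nat.floor_div_natCast, Nat.floor_div_natCast, Nat.floor_natCast]
    ext b
    simp only [Finset.mem_filter, Finset.mem_Ioc, Finset.mem_Icc]
    rw [Nat.div_lt_iff_lt_mul (by omega : 0 < k + 1), Nat.le_div_iff_mul_le hk]
    constructor
    · rintro ⟨h1, h2⟩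
      have hb : 0 < b := by
        rcases Nat.eq_zero_or_pos b with h | h
        · rw [h, zero_mul] at h1; omega
        · exact h
      refine ⟨⟨hb, by nlinarith⟩, ?_⟩
      rw [Nat.div_eq_iff hb]
      constructor
      · linarith
      · have : n < b * k + b := by linarith
        rw [mul_comm k b]; omega
    · rintro ⟨⟨h1, h2⟩, h4⟩
      rw [Nat.div_eq_iff (by omega)] at h4
      refine ⟨?_, by linarith [h4.1]⟩
      have := h4.2
      rw [mul_comm k b] at this
      have h5 : b * (k + 1) = b * k + b := by ring
      omega
  rw [hcard, hlen] at h
  rw [abs_le]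
  constructor <;> linarith [h.1, h.2]

end Layers

/-! ### Error term of one layer -/

section LayerError

theorem sum_sum_sub_smoothWeight (n k : ℕ) (F : Finset ℕ) :
    ∑ s ∈ F, ∑ z ∈ Finset.Ico (k * s) (k * s + s), smoothGain k s z * roughCount n k z
        - n * roughDensity k * ∑ s ∈ F, smoothWeight k s =
      ∑ s ∈ F, ∑ z ∈ Finset.Ico (k * s) (k * s + s), smoothGain k s z *
        (roughCount n k z - n * roughDensity k * (1 / ((z : ℝ) * (z + 1)))) := by
  rw [Finset.mul_sum, ← Finset.sum_sub_distrib]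
  refine Finset.sum_congr rfl fun s _ => ?_
  rw [smoothWeight, Finset.mul_sum, ← Finset.sum_sub_distrib]
  refine Finset.sum_congr rfl fun z _ => ?_
  ring

/-- Only smooth parts in `F` are sieved. The remaining elements are counted by complement: the size
of the layer is known to within 1, and the sieve bounds from below the number with smooth part in
`F`. No sieve estimate for large smooth parts is needed. -/
theorem abs_sum_layer_sub_le {n k : ℕ} (hk : 1 ≤ k) {F : Finset ℕ}
    (hF : ∀ s ∈ F, s ∈ (k + 1).smoothNumbers) {D : ℝ}
    (hD : ∑ s ∈ F, ∑ z ∈ Finset.Ico (k * s) (k * s + s),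
      |(roughCount n k z : ℝ) - n * roughDensity k * (1 / (z * (z + 1)))| ≤ D) :
    |∑ m ∈ layer n k, gain n m - n * layerDensity k| ≤
      gainBound k * (1 + 2 * D + 2 * (n * roughDensity k * (1 / (k * (k + 1))) *
        ((roughDensity k)⁻¹ - ∑ s ∈ F, 1 / (s : ℝ)))) := by
  classical
  set B := gainBound k with hB
  have hB0 : 0 ≤ B := gainBound_nonneg k
  set W := roughDensity k with hW
  have hW0 : 0 < W := roughDensity_pos k
  set κ : ℝ := 1 / ((k : ℝ) * (k + 1)) with hκ
  set T := W⁻¹ - ∑ s ∈ F, 1 / (s : ℝ) with hT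
  have hn0 : (0 : ℝ) ≤ n := Nat.cast_nonneg n
  have hpos : ∀ s ∈ F, 0 < s := fun s hs => Nat.pos_of_ne_zero (hF s hs).1
  set I := layer n k with hI
  have hsplit := Finset.sum_filter_add_sum_filter_not I (fun m => smoothPart k m ∈ F) (gain n)
  have hmain : ∑ m ∈ I.filter (fun m => smoothPart k m ∈ F), gain n m =
      ∑ s ∈ F, ∑ z ∈ Finset.Ico (k * s) (k * s + s), smoothGain k s z * roughCount n k z := by
    rw [← sum_layer_eq hk _ hF]
    exact Finset.sum_congr rfl fun m hm => gain_eq_of_mem_layer hk (Finset.mem_filter.1 hm).1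
  have ha : |∑ m ∈ I.filter (fun m => smoothPart k m ∈ F), gain n m
      - n * W * ∑ s ∈ F, smoothWeight k s| ≤ B * D := by
    rw [hmain, sum_sum_sub_smoothWeight]
    refine le_trans ?_ (mul_le_mul_of_nonneg_left hD hB0)
    rw [Finset.mul_sum]
    refine (Finset.abs_sum_le_sum_abs _ _).trans (Finset.sum_le_sum fun s hs => ?_)
    rw [Finset.mul_sum]
    refine (Finset.abs_sum_le_sum_abs _ _).trans (Finset.sum_le_sum fun z hz => ?_)
    rw [abs_mul, abs_of_nonneg (smoothGain_nonneg k s z)]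
    apply mul_le_mul_of_nonneg_right _ (abs_nonneg _)
    apply smoothGain_le hk (hF s hs)
    rw [Nat.div_eq_iff (hpos s hs)]
    rw [Finset.mem_Ico] at hz
    have := hpos s hs
    omega
  have hcount : ((I.filter (fun m => smoothPart k m ∈ F)).card : ℝ) =
      ∑ s ∈ F, ∑ z ∈ Finset.Ico (k * s) (k * s + s), (roughCount n k z : ℝ) := by
    have := sum_layer_eq (n := n) hk (fun _ _ => 1) hF
    simpa using this
  have hexp : n * W * κ * ∑ s ∈ F, 1 / (s : ℝ) =
      ∑ s ∈ F, ∑ z ∈ Finset.Ico (k * s) (k * s + s), n * W * (1 / ((z : ℝ) * (z + 1))) := by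
    rw [Finset.mul_sum]
    refine Finset.sum_congr rfl fun s hs => ?_
    rw [← Finset.mul_sum, sum_Ico_mul hk (hpos s hs), hκ]
    ring
  have hlow : n * W * κ * ∑ s ∈ F, 1 / (s : ℝ) - D ≤
      ((I.filter (fun m => smoothPart k m ∈ F)).card : ℝ) := by
    rw [hcount, hexp, sub_le_comm, ← Finset.sum_sub_distrib]
    refine le_trans (Finset.sum_le_sum fun s _ => ?_) hD
    rw [← Finset.sum_sub_distrib]
    refine Finset.sum_le_sum fun z _ => ?_
    rw [abs_sub_comm]
    exact le_abs_self _
  have hrest : ((I.filter (fun m => ¬ smoothPart k m ∈ F)).card : ℝ) ≤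
      1 + D + n * W * κ * T := by
    have h1 : ((I.filter (fun m => smoothPart k m ∈ F)).card : ℝ) +
        (I.filter (fun m => ¬ smoothPart k m ∈ F)).card = I.card := by
      exact_mod_cast Finset.card_filter_add_card_filter_not (s := I) _
    have h2 := (abs_le.1 (card_layer_bounds (n := n) hk)).2
    have h3 : n * W * κ * T = n * κ - n * W * κ * ∑ s ∈ F, 1 / (s : ℝ) := by
      rw [hT]; field_simp
    rw [h3]
    linarith
  have hb0 : 0 ≤ ∑ m ∈ I.filter (fun m => ¬ smoothPart k m ∈ F), gain n m :=
    Finset.sum_nonneg fun m hm => (gain_mem_Icc_of_mem_layer hk (Finset.mem_filter.1 hm).1).1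
  have hb : ∑ m ∈ I.filter (fun m => ¬ smoothPart k m ∈ F), gain n m ≤
      B * (1 + D + n * W * κ * T) := by
    refine le_trans ?_ (mul_le_mul_of_nonneg_left hrest hB0)
    rw [mul_comm, ← nsmul_eq_mul]
    exact Finset.sum_le_card_nsmul _ _ _ fun m hm =>
      (gain_mem_Icc_of_mem_layer hk (Finset.mem_filter.1 hm).1).2
  have hc := tsum_smoothWeight_sub_mem hk hF
  have hc1 : n * layerDensity k = n * W * ∑ s ∈ F, smoothWeight k s +
      n * W * ((∑' s : (k + 1).smoothNumbers, smoothWeight k s) - ∑ s ∈ F, smoothWeight k s) := by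
    rw [layerDensity]; ring
  have hc2 : 0 ≤ n * W * ((∑' s : (k + 1).smoothNumbers, smoothWeight k s)
      - ∑ s ∈ F, smoothWeight k s) := mul_nonneg (mul_nonneg hn0 hW0.le) hc.1
  have hc3 : n * W * ((∑' s : (k + 1).smoothNumbers, smoothWeight k s)
      - ∑ s ∈ F, smoothWeight k s) ≤ B * (n * W * κ * T) := by
    refine (mul_le_mul_of_nonneg_left hc.2 (mul_nonneg hn0 hW0.le)).trans (le_of_eq ?_)
    ring
  have hD0 : 0 ≤ B * D := (abs_nonneg _).trans ha
  -- The three summands are the sieve error, the gains outside `F`, and the tail of the density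
  -- series.
  have e : B * (1 + 2 * D + 2 * (n * W * κ * T)) =
      B * D + B * (1 + D + n * W * κ * T) + B * (n * W * κ * T) := by ring
  rw [← hsplit, hc1, e]
  rw [abs_le] at ha ⊢
  constructor <;> linarith [ha.1, ha.2]

/-- The factor by which Rankin's method bounds the sieve error and the mass of large smooth
parts. -/
noncomputable def rankinFactor (k : ℕ) (x δ : ℝ) : ℝ :=
  ((k : ℝ) ^ 3 / x) ^ (δ / 2) * eulerProd k δ *
    ∏ p ∈ (k + 1).primesBelow, (1 + (k : ℝ) ^ (δ / 2) / p)

open Classical in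
/-- The smooth parts below the threshold `√x / k`. -/
noncomputable def smallSmooth (k : ℕ) (x : ℝ) : Finset ℕ :=
  (smoothIcc k 1 ⌊x⌋₊).filter fun s => ((k : ℝ) * s) ^ 2 ≤ x

theorem mem_smallSmooth {k : ℕ} (hk : 1 ≤ k) {x : ℝ} {s : ℕ} :
    s ∈ smallSmooth k x ↔ s ∈ (k + 1).smoothNumbers ∧ ((k : ℝ) * s) ^ 2 ≤ x := by
  rw [smallSmooth, Finset.mem_filter, mem_smoothIcc]
  constructor
  · rintro ⟨⟨-, h1⟩, h2⟩; exact ⟨h1, h2⟩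
  · rintro ⟨h1, h2⟩
    have hs : 1 ≤ s := Nat.pos_of_ne_zero h1.1
    refine ⟨⟨⟨hs, Nat.le_floor ?_⟩, h1⟩, h2⟩
    refine le_trans ?_ h2
    have : s ≤ (k * s) ^ 2 := by
      have : s ≤ k * s := Nat.le_mul_of_pos_left s hk
      nlinarith
    exact_mod_cast this

theorem eulerProd_pos {δ : ℝ} (hδ : δ < 1) (k : ℕ) : 0 < eulerProd k δ :=
  Finset.prod_pos fun p hp => inv_pos.2 (by
    linarith [prime_rpow_sub_one_lt_one hδ (Nat.prime_of_mem_primesBelow hp)])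

theorem one_le_prod_one_add_div (Q : Finset ℕ) {lam : ℝ} (hlam : 0 ≤ lam) :
    1 ≤ ∏ p ∈ Q, (1 + lam / (p : ℝ)) :=
  Finset.prod_induction _ (fun x : ℝ => 1 ≤ x)
    (fun _ _ ha hb => one_le_mul_of_one_le_of_one_le ha hb) le_rfl fun p _ => by
      have : 0 ≤ lam / (p : ℝ) := by positivity
      linarith

theorem rpow_split {k s : ℕ} (hk : 0 < k) (hs : 0 < s) {x : ℝ} (hx : 0 < x) (j : ℕ) (δ : ℝ) :
    ((k : ℝ) ^ j * s ^ 2 / x) ^ (δ / 2) * (1 / s) =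
      ((k : ℝ) ^ j / x) ^ (δ / 2) * (s : ℝ) ^ (δ - 1) := by
  have hs0 : (0 : ℝ) < s := by exact_mod_cast hs
  have hk0 : (0 : ℝ) < k := by exact_mod_cast hk
  have e : (k : ℝ) ^ j * s ^ 2 / x = ((k : ℝ) ^ j / x) * s ^ 2 := by ring
  rw [e, Real.mul_rpow (by positivity) (by positivity), ← Real.rpow_natCast (s : ℝ) 2,
    ← Real.rpow_mul hs0.le, Real.rpow_sub_one hs0.ne']
  have : ((2 : ℕ) : ℝ) * (δ / 2) = δ := by push_cast; ring
  rw [this]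
  ring

/-- Rankin's trick: outside `smallSmooth` the weight (k²s²/x)^(δ/2) is at least 1, and the weighted
sum over all smooth s is an Euler product. The bound is then weakened to the factor that also
governs the sieve error. -/
theorem smooth_tail_le {k : ℕ} (hk : 1 ≤ k) {x δ : ℝ} (hx : 0 < x) (hδ0 : 0 ≤ δ) (hδ : δ < 1) :
    (roughDensity k)⁻¹ - ∑ s ∈ smallSmooth k x, 1 / (s : ℝ) ≤ rankinFactor k x δ := by
  have hk0 : (1 : ℝ) ≤ k := by exact_mod_cast hk
  have hF : ∀ s ∈ smallSmooth k x, s ∈ (k + 1).smoothNumbers := fun s hs =>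
    ((mem_smallSmooth hk).1 hs).1
  have h1 := (hasSum_smooth_inv k).sub (hasSum_subtype_of_finset hF fun s => 1 / (s : ℝ))
  have h2 := (hasSum_smooth hδ k).mul_left (((k : ℝ) ^ 2 / x) ^ (δ / 2))
  have h3 := hasSum_le (fun s => ?_) h1 h2
  · refine h3.trans ?_
    have hE := eulerProd_pos hδ k
    rw [rankinFactor]
    refine le_trans ?_ (le_mul_of_one_le_right (by positivity)
      (one_le_prod_one_add_div _ (by positivity)))
    apply mul_le_mul_of_nonneg_right _ hE.le
    apply Real.rpow_le_rpow (by positivity) _ (by linarith)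
    apply div_le_div_of_nonneg_right _ hx.le
    exact pow_le_pow_right₀ hk0 (by norm_num)
  · have hs0 : 0 < (s : ℕ) := Nat.pos_of_ne_zero s.2.1
    split_ifs with h
    · rw [sub_self]; positivity
    · rw [sub_zero, ← rpow_split hk hs0 hx]
      have hgt : x < ((k : ℝ) * (s : ℕ)) ^ 2 := by
        by_contra hcon
        exact h ((mem_smallSmooth hk).2 ⟨s.2, not_lt.1 hcon⟩)
      refine le_mul_of_one_le_left (by positivity) ?_
      apply Real.one_le_rpow _ (by linarith)
      rw [le_div_iff₀ hx, one_mul, ← mul_pow]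
      exact hgt.le

/-- The depth `r` is the largest with k^r ≤ x/(ks)², so the terms k^r over `s` intervals total at
most x/(k²s). With `lam` = k^(δ/2), the saving lam^(-r) becomes a Rankin weight in s; rounding `r`
down costs one factor k, which is why k³ appears. -/
theorem smooth_sieve_error_le {n k s : ℕ} (hk : 2 ≤ k) {x δ : ℝ} (hx : 0 < x) (hδ0 : 0 ≤ δ)
    (hs : 0 < s) (hsx : ((k : ℝ) * s) ^ 2 ≤ x) :
    ∑ z ∈ Finset.Ico (k * s) (k * s + s),
      |(roughCount n k z : ℝ) - n * roughDensity k * (1 / (z * (z + 1)))| ≤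
      x / k ^ 2 * (1 / s) + n / k ^ 2 * (((k : ℝ) ^ 3 / x) ^ (δ / 2) *
        (∏ p ∈ (k + 1).primesBelow, (1 + (k : ℝ) ^ (δ / 2) / p)) * (s : ℝ) ^ (δ - 1)) := by
  have hk0 : (0 : ℝ) < k := by exact_mod_cast (by omega : 0 < k)
  have hs0 : (0 : ℝ) < s := by exact_mod_cast hs
  have hn0 : (0 : ℝ) ≤ n := Nat.cast_nonneg n
  set lam : ℝ := (k : ℝ) ^ (δ / 2) with hlam
  have hlam0 : 0 < lam := by positivity
  set V := ∏ p ∈ (k + 1).primesBelow, (1 + lam / (p : ℝ)) with hV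
  have hV1 : 1 ≤ V := one_le_prod_one_add_div _ hlam0.le
  set u : ℝ := x / ((k : ℝ) * s) ^ 2 with hu
  have hu1 : 1 ≤ u := by rw [hu, one_le_div (by positivity)]; exact hsx
  have hfl : ⌊u⌋₊ ≠ 0 := by
    have : 1 ≤ ⌊u⌋₊ := Nat.le_floor (by exact_mod_cast hu1)
    omega
  set r := Nat.log k ⌊u⌋₊ with hr
  have hr1 : (k : ℝ) ^ r ≤ u := by
    refine le_trans ?_ (Nat.floor_le (by linarith))
    exact_mod_cast Nat.pow_log_le_self k hfl
  have hr2 : u ≤ (k : ℝ) ^ r * k := by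
    have h := Nat.lt_pow_succ_log_self (b := k) (by omega) ⌊u⌋₊
    have h' : ((⌊u⌋₊ : ℕ) : ℝ) + 1 ≤ (k : ℝ) ^ (r + 1) := by exact_mod_cast h
    rw [← pow_succ]
    linarith [Nat.lt_floor_add_one u]
  have hterm : ∀ z ∈ Finset.Ico (k * s) (k * s + s),
      |(roughCount n k z : ℝ) - n * roughDensity k * (1 / (z * (z + 1)))| ≤
      (k : ℝ) ^ r + n / lam ^ r * V * (1 / (z * (z + 1))) := by
    intro z hz
    rw [Finset.mem_Ico] at hz
    have hz1 : 1 ≤ z := le_trans (Nat.mul_pos (by omega) hs) hz.1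
    refine (abs_roughCount_sub_le hlam0 (by omega) hz1 r).trans (le_of_eq ?_)
    rw [← hV]; ring
  refine (Finset.sum_le_sum hterm).trans ?_
  rw [Finset.sum_add_distrib, Finset.sum_const, Nat.card_Ico, ← Finset.mul_sum,
    sum_Ico_mul (by omega) hs, nsmul_eq_mul, Nat.add_sub_cancel_left]
  apply add_le_add
  · calc (s : ℝ) * (k : ℝ) ^ r ≤ s * u := mul_le_mul_of_nonneg_left hr1 hs0.le
      _ = x / k ^ 2 * (1 / s) := by rw [hu]; field_simp
  · have hlr : 1 / lam ^ r ≤ ((k : ℝ) ^ 3 * s ^ 2 / x) ^ (δ / 2) := by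
      have e1 : lam ^ r = ((k : ℝ) ^ r) ^ (δ / 2) := by
        rw [hlam, ← Real.rpow_natCast, ← Real.rpow_natCast, ← Real.rpow_mul hk0.le,
          ← Real.rpow_mul hk0.le, mul_comm]
      rw [e1, one_div, ← Real.inv_rpow (by positivity)]
      apply Real.rpow_le_rpow (by positivity) _ (by linarith)
      rw [inv_le_comm₀ (by positivity) (by positivity)]
      have e2 : ((k : ℝ) ^ 3 * s ^ 2 / x)⁻¹ = u / k := by rw [hu]; field_simp
      rw [e2, div_le_iff₀ hk0]
      exact hr2
    have hkk : 1 / ((k : ℝ) * (k + 1)) ≤ 1 / k ^ 2 := by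
      apply one_div_le_one_div_of_le (by positivity); nlinarith
    calc n / lam ^ r * V * (1 / ((k : ℝ) * (k + 1)) * (1 / s))
        = n * V * (1 / s) * (1 / lam ^ r) * (1 / ((k : ℝ) * (k + 1))) := by ring
      _ ≤ n * V * (1 / s) * ((k : ℝ) ^ 3 * s ^ 2 / x) ^ (δ / 2) * (1 / k ^ 2) := by
          gcongr
      _ = n / k ^ 2 * (V * (((k : ℝ) ^ 3 * s ^ 2 / x) ^ (δ / 2) * (1 / s))) := by ring
      _ = n / k ^ 2 * (((k : ℝ) ^ 3 / x) ^ (δ / 2) * V * (s : ℝ) ^ (δ - 1)) := by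
          rw [rpow_split (by omega) hs hx]; ring

theorem layer_error_le {n k : ℕ} (hk : 2 ≤ k) {x δ : ℝ} (hx : 0 < x) (hδ0 : 0 ≤ δ) (hδ : δ < 1) :
    |∑ m ∈ layer n k, gain n m - n * layerDensity k| ≤
      gainBound k * (1 + 2 * (x / k) + 4 * (n / k ^ 2 * rankinFactor k x δ)) := by
  have hk1 : 1 ≤ k := by omega
  have hk0 : (0 : ℝ) < k := by exact_mod_cast (by omega : 0 < k)
  have hn0 : (0 : ℝ) ≤ n := Nat.cast_nonneg n
  have hF : ∀ s ∈ smallSmooth k x, s ∈ (k + 1).smoothNumbers := fun s hs =>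
    ((mem_smallSmooth hk1).1 hs).1
  have hV1 := one_le_prod_one_add_div (k + 1).primesBelow (lam := (k : ℝ) ^ (δ / 2)) (by positivity)
  set V := ∏ p ∈ (k + 1).primesBelow, (1 + (k : ℝ) ^ (δ / 2) / p) with hV
  have hsum1 : ∑ s ∈ smallSmooth k x, 1 / (s : ℝ) ≤ k := by
    refine le_trans ?_ (inv_roughDensity_le hk1)
    refine hasSum_le (fun s => ?_) (hasSum_subtype_of_finset hF fun s => 1 / (s : ℝ))
      (hasSum_smooth_inv k)
    split_ifs
    · exact le_rfl
    · positivity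
  have hsum2 : ∑ s ∈ smallSmooth k x, (s : ℝ) ^ (δ - 1) ≤ eulerProd k δ := by
    refine hasSum_le (fun s => ?_) (hasSum_subtype_of_finset hF fun s => (s : ℝ) ^ (δ - 1))
      (hasSum_smooth hδ k)
    split_ifs
    · exact le_rfl
    · positivity
  have hD : ∑ s ∈ smallSmooth k x, ∑ z ∈ Finset.Ico (k * s) (k * s + s),
      |(roughCount n k z : ℝ) - n * roughDensity k * (1 / (z * (z + 1)))| ≤
      x / k + n / k ^ 2 * rankinFactor k x δ := by
    refine (Finset.sum_le_sum fun s hs => smooth_sieve_error_le hk hx hδ0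
      (Nat.pos_of_ne_zero (hF s hs).1) ((mem_smallSmooth hk1).1 hs).2).trans ?_
    rw [Finset.sum_add_distrib, ← Finset.mul_sum, ← Finset.mul_sum, ← Finset.mul_sum, ← hV]
    apply add_le_add
    · calc x / k ^ 2 * ∑ s ∈ smallSmooth k x, 1 / (s : ℝ) ≤ x / k ^ 2 * k :=
            mul_le_mul_of_nonneg_left hsum1 (by positivity)
        _ = x / k := by field_simp
    · apply mul_le_mul_of_nonneg_left _ (by positivity)
      rw [rankinFactor, ← hV, mul_right_comm]
      apply mul_le_mul_of_nonneg_right _ (by linarith)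
      exact mul_le_mul_of_nonneg_left hsum2 (by positivity)
  refine (abs_sum_layer_sub_le hk1 hF hD).trans ?_
  apply mul_le_mul_of_nonneg_left _ (gainBound_nonneg k)
  have hT := smooth_tail_le hk1 hx hδ0 hδ
  have hR0 : 0 ≤ rankinFactor k x δ := by
    have := eulerProd_pos hδ k
    rw [rankinFactor, ← hV]
    have : 0 ≤ V := by linarith
    positivity
  have hW := roughDensity_le_one k
  have hW0 := roughDensity_pos k
  have hkk : 1 / ((k : ℝ) * (k + 1)) ≤ 1 / k ^ 2 := by
    apply one_div_le_one_div_of_le (by positivity); nlinarith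
  have : n * roughDensity k * (1 / (k * (k + 1))) *
      ((roughDensity k)⁻¹ - ∑ s ∈ smallSmooth k x, 1 / (s : ℝ)) ≤
      n / k ^ 2 * rankinFactor k x δ := by
    calc _ ≤ n * roughDensity k * (1 / (k * (k + 1))) * rankinFactor k x δ :=
          mul_le_mul_of_nonneg_left hT (by positivity)
      _ ≤ n * 1 * (1 / k ^ 2) * rankinFactor k x δ := by gcongr
      _ = _ := by ring
  linarith

end LayerError

/-! ### Summing over the layers -/

section Global

theorem gainBound_one : gainBound 1 = 0 := by simp [gainBound]

theorem gainBound_le {k : ℕ} (hk : 1 ≤ k) : gainBound k ≤ 2 * (Real.log k + 1) := by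
  have hk0 : (1 : ℝ) ≤ k := by exact_mod_cast hk
  have he2 : (2 : ℝ) ≤ Real.exp 1 := by linarith [Real.add_one_le_exp (1 : ℝ)]
  rw [gainBound, Real.log_le_iff_le_exp (by nlinarith [sq_nonneg ((k : ℝ) - 1)])]
  have e : Real.exp (2 * (Real.log k + 1)) = (k * Real.exp 1) ^ 2 := by
    rw [two_mul, Real.exp_add, Real.exp_add, Real.exp_log (by linarith)]; ring
  rw [e]
  have h2 : (2 * (k : ℝ)) ^ 2 ≤ (k * Real.exp 1) ^ 2 :=
    pow_le_pow_left₀ (by linarith) (by nlinarith) 2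
  nlinarith

theorem gainBound_mono {k l : ℕ} (hk : 1 ≤ k) (hkl : k ≤ l) : gainBound k ≤ gainBound l := by
  have hk0 : (1 : ℝ) ≤ k := by exact_mod_cast hk
  have hkl' : (k : ℝ) ≤ l := by exact_mod_cast hkl
  apply Real.log_le_log (by nlinarith [sq_nonneg ((k : ℝ) - 1)])
  nlinarith

/-- A telescoping majorant of the tail of the series of layer densities. -/
noncomputable def tailBound (k : ℕ) : ℝ := (Real.log k + 2) / k

/-- The derivative of (log k + 2)/k is -(log k + 1)/k², and the density is at most 2(log k +
1)/(k(k+1)). The discrete version rests on log(1 + 1/k) ≤ 1/k. -/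
theorem layerDensity_le_tailBound_sub {k : ℕ} (hk : 1 ≤ k) :
    layerDensity k ≤ 2 * (tailBound k - tailBound (k + 1)) := by
  have hk0 : (0 : ℝ) < k := by exact_mod_cast hk
  have h1 : Real.log ((k : ℝ) + 1) ≤ Real.log k + 1 / k := by
    have e : (k : ℝ) + 1 = k * (1 + 1 / k) := by field_simp
    rw [e, Real.log_mul hk0.ne' (by positivity)]
    have := Real.log_le_sub_one_of_pos (show (0 : ℝ) < 1 + 1 / k by positivity)
    linarith
  have h2 : tailBound k - tailBound (k + 1) =
      ((k + 1) * (Real.log k + 2) - k * (Real.log (k + 1) + 2)) * (1 / (k * (k + 1))) := by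
    rw [tailBound, tailBound]; push_cast; field_simp
  refine (layerDensity_le hk).trans ?_
  rw [h2, ← mul_assoc]
  apply mul_le_mul_of_nonneg_right _ (by positivity)
  refine (gainBound_le hk).trans ?_
  have h3 : k * Real.log ((k : ℝ) + 1) ≤ k * Real.log k + 1 := by
    have := mul_le_mul_of_nonneg_left h1 hk0.le
    rwa [mul_add, mul_one_div_cancel hk0.ne'] at this
  nlinarith

theorem tailBound_nonneg (k : ℕ) : 0 ≤ tailBound k :=
  div_nonneg (by linarith [Real.log_natCast_nonneg k]) (Nat.cast_nonneg k)

theorem sum_layerDensity_le {K : ℕ} (hK : 1 ≤ K) (N : ℕ) :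
    ∑ j ∈ Finset.range N, layerDensity (j + K) ≤ 2 * tailBound K := by
  have h : ∑ j ∈ Finset.range N, layerDensity (j + K) ≤
      2 * (tailBound K - tailBound (N + K)) := by
    induction N with
    | zero => simp
    | succ N ih =>
      rw [Finset.sum_range_succ]
      have := layerDensity_le_tailBound_sub (k := N + K) (by omega)
      rw [show N + 1 + K = N + K + 1 by ring]
      linarith
  linarith [tailBound_nonneg (N + K)]

theorem summable_layerDensity : Summable fun k => layerDensity (k + 1) :=
  summable_of_sum_range_le (fun k => layerDensity_nonneg (by omega))
    (sum_layerDensity_le le_rfl)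

/-- The logarithm of the growth constant. -/
noncomputable def logGrowth : ℝ := ∑' k, layerDensity (k + 1)

theorem logGrowth_sub_mem (K : ℕ) :
    0 ≤ logGrowth - ∑ k ∈ Finset.Icc 1 K, layerDensity k ∧
      logGrowth - ∑ k ∈ Finset.Icc 1 K, layerDensity k ≤ 2 * tailBound (K + 1) := by
  have h1 := summable_layerDensity.sum_add_tsum_nat_add K
  have h2 : ∑ k ∈ Finset.Icc 1 K, layerDensity k = ∑ k ∈ Finset.range K, layerDensity (k + 1) := by
    rw [Finset.range_eq_Ico, Finset.sum_Ico_add' (fun k => layerDensity k) 0 K 1]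
    rfl
  rw [h2, logGrowth, ← h1, add_sub_cancel_left]
  have h3 : ∀ j, layerDensity (j + K + 1) = layerDensity (j + (K + 1)) := fun j => rfl
  simp only [h3]
  refine ⟨tsum_nonneg fun j => layerDensity_nonneg (by omega), ?_⟩
  exact Real.tsum_le_of_sum_range_le (fun j => layerDensity_nonneg (by omega))
    (sum_layerDensity_le (by omega))

theorem smoothWeight_le_tsum {k s : ℕ} (hk : 1 ≤ k) (hs : s ∈ (k + 1).smoothNumbers) :
    smoothWeight k s ≤ ∑' s : (k + 1).smoothNumbers, smoothWeight k s :=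
  (summable_smoothWeight hk).le_tsum (⟨s, hs⟩ : (k + 1).smoothNumbers)
    fun s _ => (smoothWeight_mem hk s.2).1

/-- One term suffices: adjoining 1 to {2} doubles the count. Positivity of `logGrowth` follows, and
it is what allows the error to be moved into the exponent of c_d. -/
theorem layerDensity_two_pos : 0 < layerDensity 2 := by
  have h1 : (1 : ℕ) ∈ (2 + 1).smoothNumbers := Nat.mem_smoothNumbers_of_lt (by norm_num) (by norm_num)
  have h2 : (2 : ℕ) ∈ (2 + 1).smoothNumbers := Nat.mem_smoothNumbers_of_lt (by norm_num) (by norm_num)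
  have e1 : smoothIcc 2 1 2 = {1, 2} := by
    ext t
    rw [mem_smoothIcc, Finset.mem_insert, Finset.mem_singleton]
    constructor
    · rintro ⟨⟨h, h'⟩, -⟩; omega
    · rintro (rfl | rfl)
      exacts [⟨by norm_num, h1⟩, ⟨by norm_num, h2⟩]
  have e2 : smoothIcc 2 (1 + 1) 2 = {2} := by
    ext t
    rw [mem_smoothIcc, Finset.mem_singleton]
    constructor
    · rintro ⟨⟨h, h'⟩, -⟩; omega
    · rintro rfl
      exact ⟨by norm_num, h2⟩
  have hG : 0 < smoothGain 2 1 2 := by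
    rw [smoothGain, e1, e2, coverCount_one_two, coverCount_singleton]
    simpa using Real.log_pos (by norm_num : (1 : ℝ) < 2)
  have hW : 0 < smoothWeight 2 1 := by
    rw [smoothWeight]
    have : Finset.Ico (2 * 1) (2 * 1 + 1) = {2} := by ext; simp
    rw [this, Finset.sum_singleton]
    exact mul_pos hG (by norm_num)
  exact mul_pos (roughDensity_pos 2) (hW.trans_le (smoothWeight_le_tsum (by norm_num) h1))

theorem logGrowth_pos : 0 < logGrowth := by
  have h := (logGrowth_sub_mem 2).1
  have e : Finset.Icc 1 2 = ({1, 2} : Finset ℕ) := by decide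
  rw [e, Finset.sum_pair (by norm_num)] at h
  linarith [layerDensity_nonneg (k := 1) le_rfl, layerDensity_two_pos]

theorem abs_log_coverCount_sub_le {n K : ℕ} (hK : 1 ≤ K) {x : ℝ}
    (hx : 0 < x) (δ : ℕ → ℝ) (hδ : ∀ k ∈ Finset.Icc 2 K, 0 ≤ δ k ∧ δ k < 1) :
    |Real.log (coverCount (Finset.Icc 1 n)) - n * logGrowth| ≤
      ∑ k ∈ Finset.Icc 2 K,
        gainBound k * (1 + 2 * (x / k) + 4 * (n / k ^ 2 * rankinFactor k x (δ k))) +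
      n / (K + 1) * gainBound n + 2 * (n * tailBound (K + 1)) := by
  have hn0 : (0 : ℝ) ≤ n := Nat.cast_nonneg n
  have hsplit := Finset.sum_filter_add_sum_filter_not (Finset.Icc 1 n)
    (fun m => n / m ∈ Finset.Icc 1 K) (gain n)
  have h1 : ∑ m ∈ (Finset.Icc 1 n).filter (fun m => n / m ∈ Finset.Icc 1 K), gain n m =
      ∑ k ∈ Finset.Icc 1 K, ∑ m ∈ layer n k, gain n m := by
    rw [← Finset.sum_fiberwise_of_maps_to (t := Finset.Icc 1 K) (g := fun m => n / m)
      (fun m hm => (Finset.mem_filter.1 hm).2)]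
    refine Finset.sum_congr rfl fun k hk => ?_
    rw [Finset.filter_filter, layer]
    refine Finset.sum_congr (Finset.filter_congr fun m _ => ?_) fun _ _ => rfl
    constructor
    · rintro ⟨-, h⟩; exact h
    · rintro rfl; exact ⟨hk, rfl⟩
  have hrest : ∀ m ∈ (Finset.Icc 1 n).filter (fun m => ¬ n / m ∈ Finset.Icc 1 K),
      0 ≤ gain n m ∧ gain n m ≤ gainBound n := by
    intro m hm
    rw [Finset.mem_filter] at hm
    have hm' := Finset.mem_Icc.1 hm.1
    have hk : 1 ≤ n / m := (Nat.one_le_div_iff hm'.1).2 hm'.2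
    have := gain_mem_Icc_of_mem_layer hk (Finset.mem_filter.2 ⟨hm.1, rfl⟩)
    exact ⟨this.1, this.2.trans (gainBound_mono hk (Nat.div_le_self n m))⟩
  have hcard : (((Finset.Icc 1 n).filter (fun m => ¬ n / m ∈ Finset.Icc 1 K)).card : ℝ) ≤
      n / (K + 1) := by
    have hsub : (Finset.Icc 1 n).filter (fun m => ¬ n / m ∈ Finset.Icc 1 K) ⊆
        Finset.Icc 1 (n / (K + 1)) := by
      intro m hm
      rw [Finset.mem_filter, Finset.mem_Icc, Finset.mem_Icc] at hm
      have hk : 1 ≤ n / m := (Nat.one_le_div_iff hm.1.1).2 hm.1.2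
      rw [Finset.mem_Icc, Nat.le_div_iff_mul_le (by omega)]
      refine ⟨hm.1.1, ?_⟩
      have : K + 1 ≤ n / m := by
        by_contra h
        exact hm.2 ⟨hk, by omega⟩
      rw [Nat.le_div_iff_mul_le hm.1.1] at this
      linarith
    have := Finset.card_le_card hsub
    rw [Nat.card_Icc, Nat.add_sub_cancel] at this
    refine le_trans (Nat.cast_le.2 this) ?_
    have := Nat.cast_div_le (α := ℝ) (m := n) (n := K + 1)
    push_cast at this
    exact this
  have h2 : 0 ≤ ∑ m ∈ (Finset.Icc 1 n).filter (fun m => ¬ n / m ∈ Finset.Icc 1 K), gain n m :=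
    Finset.sum_nonneg fun m hm => (hrest m hm).1
  have h3 : ∑ m ∈ (Finset.Icc 1 n).filter (fun m => ¬ n / m ∈ Finset.Icc 1 K), gain n m ≤
      n / (K + 1) * gainBound n := by
    refine (Finset.sum_le_card_nsmul _ _ _ fun m hm => (hrest m hm).2).trans ?_
    rw [nsmul_eq_mul]
    exact mul_le_mul_of_nonneg_right hcard (gainBound_nonneg n)
  have hIcc : Finset.Icc 1 K = insert 1 (Finset.Icc 2 K) := by
    ext k; simp only [Finset.mem_insert, Finset.mem_Icc]; omega
  have h4 : |∑ k ∈ Finset.Icc 1 K, (∑ m ∈ layer n k, gain n m - n * layerDensity k)| ≤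
      ∑ k ∈ Finset.Icc 2 K,
        gainBound k * (1 + 2 * (x / k) + 4 * (n / k ^ 2 * rankinFactor k x (δ k))) := by
    -- Integers above n/2 have no neighbour in (m, n], so the layer k = 1 is exact.
    have hone : |∑ m ∈ layer n 1, gain n m - n * layerDensity 1| ≤ 0 := by
      have := abs_sum_layer_sub_le (n := n) (k := 1) le_rfl (F := ∅) (by simp) (D := 0) (by simp)
      rwa [gainBound_one, zero_mul] at this
    rw [hIcc, Finset.sum_insert (by simp)]
    refine (abs_add_le _ _).trans ?_
    have : |∑ k ∈ Finset.Icc 2 K, (∑ m ∈ layer n k, gain n m - n * layerDensity k)| ≤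
        ∑ k ∈ Finset.Icc 2 K,
        gainBound k * (1 + 2 * (x / k) + 4 * (n / k ^ 2 * rankinFactor k x (δ k))) := by
      refine (Finset.abs_sum_le_sum_abs _ _).trans (Finset.sum_le_sum fun k hk => ?_)
      exact layer_error_le (Finset.mem_Icc.1 hk).1 hx (hδ k hk).1 (hδ k hk).2
    linarith
  rw [Finset.sum_sub_distrib, ← Finset.mul_sum] at h4
  have h5 := logGrowth_sub_mem K
  have h6 := mul_nonneg hn0 h5.1
  have h7 := mul_le_mul_of_nonneg_left h5.2 hn0
  rw [log_coverCount_Icc, ← hsplit, h1]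
  rw [abs_le] at h4 ⊢
  constructor <;> linarith [h4.1, h4.2]

/-- With x = n/L and the cut at K = ⌊L⌋, the x-term of the sieve error and the discarded layers are
both of relative size 1/L up to logarithms. The sum of 1/k over the layers costs one further
logarithm. -/
theorem abs_log_coverCount_sub_le' {n : ℕ} (hn : 1 ≤ n) {L E : ℝ} (hL : 1 ≤ L) (hLn : L ≤ n)
    (δ : ℕ → ℝ) (hδ : ∀ k : ℕ, 2 ≤ k → (k : ℝ) ≤ L → 0 ≤ δ k ∧ δ k < 1 ∧
      rankinFactor k (n / L) (δ k) / k ≤ E) (hE : 0 ≤ E) :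
    |Real.log (coverCount (Finset.Icc 1 n)) - n * logGrowth| ≤
      2 * (Real.log n + 3) * L + n * (Real.log n + 3) ^ 2 * (8 / L + 8 * E) := by
  have hn0 : (1 : ℝ) ≤ n := by exact_mod_cast hn
  have hL0 : 0 < L := by linarith
  set K := ⌊L⌋₊ with hKdef
  have hK : 1 ≤ K := Nat.le_floor (by exact_mod_cast hL)
  have hKL : (K : ℝ) ≤ L := Nat.floor_le hL0.le
  have hLK : L ≤ K + 1 := (Nat.lt_floor_add_one L).le
  have hKn : K ≤ n := by exact_mod_cast hKL.trans hLn
  have hkL : ∀ k ∈ Finset.Icc 2 K, (k : ℝ) ≤ L := fun k hk =>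
    le_trans (by exact_mod_cast (Finset.mem_Icc.1 hk).2) hKL
  have h := abs_log_coverCount_sub_le (n := n) hK (x := n / L) (by positivity) δ
    (fun k hk => ⟨(hδ k (Finset.mem_Icc.1 hk).1 (hkL k hk)).1,
      (hδ k (Finset.mem_Icc.1 hk).1 (hkL k hk)).2.1⟩)
  refine h.trans ?_
  set M := Real.log n + 3 with hM
  have hlog : 0 ≤ Real.log n := Real.log_nonneg hn0
  have hM3 : 3 ≤ M := by linarith
  have hgb : ∀ k : ℕ, 1 ≤ k → k ≤ n → gainBound k ≤ 2 * M := by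
    intro k hk hkn
    refine (gainBound_mono hk hkn).trans ((gainBound_le hn).trans ?_)
    linarith
  have hharm : ∑ k ∈ Finset.Icc 2 K, 1 / (k : ℝ) ≤ M := by
    have h1 := harmonic_le_one_add_log K
    rw [harmonic_eq_sum_Icc] at h1
    push_cast at h1
    have h2 : ∑ k ∈ Finset.Icc 2 K, 1 / (k : ℝ) ≤ ∑ k ∈ Finset.Icc 1 K, ((k : ℝ))⁻¹ := by
      simp only [one_div]
      refine Finset.sum_le_sum_of_subset_of_nonneg (Finset.Icc_subset_Icc_left (by norm_num)) ?_
      intro k _ _; positivity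
    have h3 : Real.log K ≤ Real.log n := Real.log_le_log (by exact_mod_cast hK) (by exact_mod_cast hKn)
    linarith
  have hsum : ∑ k ∈ Finset.Icc 2 K,
      gainBound k * (1 + 2 * (n / L / k) + 4 * (n / k ^ 2 * rankinFactor k (n / L) (δ k))) ≤
      2 * M * (L + (2 * (n / L) + 4 * (n * E)) * M) := by
    have hterm : ∀ k ∈ Finset.Icc 2 K,
        gainBound k * (1 + 2 * (n / L / k) + 4 * (n / k ^ 2 * rankinFactor k (n / L) (δ k))) ≤
        2 * M * (1 + (2 * (n / L) + 4 * (n * E)) * (1 / k)) := by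
      intro k hk
      have hk' := Finset.mem_Icc.1 hk
      have hk0 : (0 : ℝ) < k := by exact_mod_cast (by omega : 0 < k)
      have e : 1 + 2 * (n / L / k) + 4 * (n / k ^ 2 * rankinFactor k (n / L) (δ k)) ≤
          1 + (2 * (n / L) + 4 * (n * E)) * (1 / k) := by
        have h1 : (n : ℝ) / k ^ 2 * rankinFactor k (n / L) (δ k) =
            n / k * (rankinFactor k (n / L) (δ k) / k) := by field_simp
        have h2 := mul_le_mul_of_nonneg_left (hδ k hk'.1 (hkL k hk)).2.2
          (show (0 : ℝ) ≤ n / k by positivity)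
        have h3 : 1 + (2 * (n / L) + 4 * (n * E)) * (1 / k) =
          1 + 2 * (n / L / k) + 4 * (n / k * E) := by ring
        rw [h1, h3]
        linarith
      refine (mul_le_mul_of_nonneg_left e (gainBound_nonneg k)).trans ?_
      exact mul_le_mul_of_nonneg_right (hgb k (by omega) (by omega)) (by positivity)
    refine (Finset.sum_le_sum hterm).trans ?_
    rw [← Finset.mul_sum, Finset.sum_add_distrib, ← Finset.mul_sum, Finset.sum_const,
      nsmul_eq_mul, mul_one]
    have hc : ((Finset.Icc 2 K).card : ℝ) ≤ L := by
      refine le_trans ?_ hKL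
      rw [Nat.card_Icc]; exact_mod_cast (by omega)
    gcongr
  have hinv : 1 / ((K : ℝ) + 1) ≤ 1 / L := one_div_le_one_div_of_le hL0 hLK
  have h2 : n / (K + 1) * gainBound n ≤ n * M * (2 / L) := by
    have h1 : (n : ℝ) / (K + 1) ≤ n / L := div_le_div_of_nonneg_left (by linarith) hL0 hLK
    calc n / (K + 1) * gainBound n ≤ n / L * (2 * M) :=
          mul_le_mul h1 (hgb n hn le_rfl) (gainBound_nonneg n) (by positivity)
      _ = n * M * (2 / L) := by ring
  have h3 : n * tailBound (K + 1) ≤ n * M * (1 / L) := by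
    rw [mul_assoc]
    apply mul_le_mul_of_nonneg_left _ (by linarith)
    rw [tailBound]
    have h4 : Real.log ((K + 1 : ℕ) : ℝ) ≤ Real.log n + 1 := by
      have h5 : ((K + 1 : ℕ) : ℝ) ≤ n * 2 := by
        exact_mod_cast (by omega : K + 1 ≤ n * 2)
      refine (Real.log_le_log (by positivity) h5).trans ?_
      rw [Real.log_mul (by linarith) (by norm_num)]
      linarith [Real.log_two_lt_d9]
    rw [div_eq_mul_one_div]
    push_cast at h4 ⊢
    have hKlog : 0 ≤ Real.log ((K : ℝ) + 1) := Real.log_nonneg (by linarith)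
    exact mul_le_mul (by linarith) hinv (by positivity) (by linarith)
  have e : 2 * M * L + n * M ^ 2 * (8 / L + 8 * E) =
      2 * M * (L + (2 * (n / L) + 4 * (n * E)) * M) + n * M * (4 / L) * M := by ring
  rw [e]
  have h5 : n * M * (4 / L) ≤ n * M * (4 / L) * M :=
    le_mul_of_one_le_right (by positivity) (by linarith)
  have h6 : n * M * (4 / L) = n * M * (2 / L) + 2 * (n * M * (1 / L)) := by ring
  linarith

end Global

/-! ### Sums and products over primes -/

section PrimeSums

/-- Chebyshev's bound θ(y) ≤ y log 4 at y = 2^(i+1), divided by 2^i · i log 2, gives the constant 4.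
Mertens' sharper constant is not needed. -/
theorem sum_inv_primes_dyadic_le {i : ℕ} (hi : 1 ≤ i) :
    ∑ p ∈ (Finset.Ioc (2 ^ i) (2 ^ (i + 1))).filter Nat.Prime, 1 / (p : ℝ) ≤ 4 * (i : ℝ)⁻¹ := by
  have hi0 : (0 : ℝ) < i := by exact_mod_cast hi
  have hl2 : 0 < Real.log 2 := Real.log_pos (by norm_num)
  have hpow : (0 : ℝ) < 2 ^ i := by positivity
  have hterm : ∀ p ∈ (Finset.Ioc (2 ^ i) (2 ^ (i + 1))).filter Nat.Prime,
      1 / (p : ℝ) ≤ Real.log p * (1 / (2 ^ i * (i * Real.log 2))) := by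
    intro p hp
    rw [Finset.mem_filter, Finset.mem_Ioc] at hp
    have hp1 : (2 : ℝ) ^ i ≤ p := by exact_mod_cast hp.1.1.le
    have h1 : i * Real.log 2 ≤ Real.log p := by
      rw [← Real.log_pow]
      exact Real.log_le_log hpow hp1
    calc 1 / (p : ℝ) ≤ 1 / 2 ^ i := one_div_le_one_div_of_le hpow hp1
      _ = (i * Real.log 2) * (1 / (2 ^ i * (i * Real.log 2))) := by field_simp
      _ ≤ _ := mul_le_mul_of_nonneg_right h1 (by positivity)
  refine (Finset.sum_le_sum hterm).trans ?_
  rw [← Finset.sum_mul]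
  have hθ : ∑ p ∈ (Finset.Ioc (2 ^ i) (2 ^ (i + 1))).filter Nat.Prime, Real.log p ≤
      Real.log 4 * 2 ^ (i + 1) := by
    refine le_trans ?_ (Chebyshev.theta_le_log4_mul_x (by positivity))
    rw [Chebyshev.theta]
    refine Finset.sum_le_sum_of_subset_of_nonneg ?_ fun p _ _ => Real.log_natCast_nonneg p
    intro p hp
    rw [Finset.mem_filter, Finset.mem_Ioc] at hp ⊢
    refine ⟨⟨hp.2.pos, Nat.le_floor ?_⟩, hp.2⟩
    exact_mod_cast hp.1.2
  refine (mul_le_mul_of_nonneg_right hθ (by positivity)).trans (le_of_eq ?_)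
  have h4 : Real.log 4 = 2 * Real.log 2 := by
    rw [show (4 : ℝ) = 2 ^ 2 by norm_num, Real.log_pow]; norm_num
  rw [h4, pow_succ]
  field_simp
  norm_num

theorem sum_inv_primes_pow_two_le (J : ℕ) :
    ∑ p ∈ Nat.primesBelow (2 ^ (J + 1) + 1), 1 / (p : ℝ) ≤ 1 + 4 * (harmonic J : ℝ) := by
  induction J with
  | zero =>
    have : Nat.primesBelow (2 ^ (0 + 1) + 1) = {2} := by decide
    rw [this]
    norm_num
  | succ J ih =>
    have hsplit : (2 ^ (J + 1 + 1) + 1).primesBelow = (2 ^ (J + 1) + 1).primesBelow ∪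
        (Finset.Ioc (2 ^ (J + 1)) (2 ^ (J + 1 + 1))).filter Nat.Prime := by
      ext p
      have h : 2 ^ (J + 1) ≤ 2 ^ (J + 1 + 1) := Nat.pow_le_pow_right (by norm_num) (by omega)
      simp only [Finset.mem_union, Nat.mem_primesBelow, Finset.mem_filter, Finset.mem_Ioc]
      constructor
      · rintro ⟨h1, h2⟩
        by_cases h3 : p ≤ 2 ^ (J + 1)
        · exact Or.inl ⟨by omega, h2⟩
        · exact Or.inr ⟨⟨by omega, by omega⟩, h2⟩
      · rintro (⟨h1, h2⟩ | ⟨⟨h1, h3⟩, h2⟩)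
        · exact ⟨by omega, h2⟩
        · exact ⟨by omega, h2⟩
    have hdisj : Disjoint (2 ^ (J + 1) + 1).primesBelow
        ((Finset.Ioc (2 ^ (J + 1)) (2 ^ (J + 1 + 1))).filter Nat.Prime) := by
      rw [Finset.disjoint_left]
      intro p hp hp'
      rw [Nat.mem_primesBelow] at hp
      rw [Finset.mem_filter, Finset.mem_Ioc] at hp'
      omega
    rw [hsplit, Finset.sum_union hdisj, harmonic_succ]
    have := sum_inv_primes_dyadic_le (i := J + 1) (by omega)
    push_cast at this ⊢
    linarith

theorem sum_inv_primesBelow_le {k : ℕ} (hk : 1 ≤ k) :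
    ∑ p ∈ (k + 1).primesBelow, 1 / (p : ℝ) ≤ 5 + 4 * Real.log (2 * Real.log k + 1) := by
  have hk0 : (1 : ℝ) ≤ k := by exact_mod_cast hk
  have hlogk : 0 ≤ Real.log k := Real.log_nonneg hk0
  set J := Nat.log 2 k with hJ
  have h1 : ∑ p ∈ (k + 1).primesBelow, 1 / (p : ℝ) ≤
      ∑ p ∈ Nat.primesBelow (2 ^ (J + 1) + 1), 1 / (p : ℝ) := by
    refine Finset.sum_le_sum_of_subset_of_nonneg ?_ fun p _ _ => by positivity
    intro p hp
    rw [Nat.mem_primesBelow] at hp ⊢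
    have := Nat.lt_pow_succ_log_self (b := 2) (by norm_num) k
    exact ⟨by rw [← hJ, Nat.succ_eq_add_one] at this; omega, hp.2⟩
  refine h1.trans ((sum_inv_primes_pow_two_le J).trans ?_)
  have h2 := harmonic_le_one_add_log J
  have h3 : Real.log J ≤ Real.log (2 * Real.log k + 1) := by
    rcases Nat.eq_zero_or_pos J with h | h
    · rw [h, Nat.cast_zero, Real.log_zero]
      exact Real.log_nonneg (by linarith)
    · have h4 : (J : ℝ) * Real.log 2 ≤ Real.log k := by
        rw [← Real.log_pow]
        apply Real.log_le_log (by positivity)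
        exact_mod_cast Nat.pow_log_le_self 2 (by omega)
      have h5 := Real.log_two_gt_d9
      have hJ0 : (0 : ℝ) < J := by exact_mod_cast h
      apply Real.log_le_log hJ0
      nlinarith
  linarith

theorem eulerProd_le_exp {k : ℕ} {δ : ℝ} (hδ0 : 0 ≤ δ) (hδ : δ ≤ 1 / 2) :
    eulerProd k δ ≤ Real.exp (4 * ((k : ℝ) ^ δ * ∑ p ∈ (k + 1).primesBelow, 1 / (p : ℝ))) := by
  rw [eulerProd, Finset.mul_sum, Finset.mul_sum, Real.exp_sum]
  refine Finset.prod_le_prod (fun p hp => ?_) fun p hp => ?_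
  · rw [inv_nonneg, sub_nonneg]
    exact (prime_rpow_sub_one_lt_one (by linarith) (Nat.prime_of_mem_primesBelow hp)).le
  · rw [Nat.mem_primesBelow] at hp
    have hp2 : (2 : ℝ) ≤ p := by exact_mod_cast hp.2.two_le
    have hpk : (p : ℝ) ≤ k := by exact_mod_cast (by omega : p ≤ k)
    set t := (p : ℝ) ^ (δ - 1) with ht
    have ht0 : 0 ≤ t := by positivity
    -- The condition δ ≤ 1/2 keeps p^(δ-1) below 2^(-1/2) ≤ 3/4, a range in which (1 - t)⁻¹ ≤ 1 +
    -- 4t.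
    have ht1 : t ≤ 3 / 4 := by
      have h1 : t ≤ (p : ℝ) ^ (-(1 / 2) : ℝ) :=
        Real.rpow_le_rpow_of_exponent_le (by linarith) (by linarith)
      have h2 : (p : ℝ) ^ (-(1 / 2) : ℝ) ≤ (2 : ℝ) ^ (-(1 / 2) : ℝ) :=
        Real.rpow_le_rpow_of_nonpos (by norm_num) hp2 (by norm_num)
      have h3 : (2 : ℝ) ^ (-(1 / 2) : ℝ) ≤ 3 / 4 := by
        rw [Real.rpow_neg (by norm_num), ← Real.sqrt_eq_rpow, inv_le_comm₀ (by positivity) (by norm_num)]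
        apply Real.le_sqrt_of_sq_le
        norm_num
      linarith
    have ht2 : t ≤ (k : ℝ) ^ δ * (1 / p) := by
      rw [ht, Real.rpow_sub_one (by positivity), div_eq_mul_one_div]
      exact mul_le_mul_of_nonneg_right (Real.rpow_le_rpow (by linarith) hpk hδ0) (by positivity)
    calc (1 - t)⁻¹ ≤ 1 + 4 * t := by
          rw [inv_le_iff_one_le_mul₀ (by linarith)]
          nlinarith
      _ ≤ Real.exp (4 * t) := by linarith [Real.add_one_le_exp (4 * t)]
      _ ≤ _ := Real.exp_le_exp.2 (by linarith)

theorem rankinFactor_div_le {k : ℕ} (hk : 1 ≤ k) {x δ : ℝ} (hx : 0 < x) (hδ0 : 0 ≤ δ)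
    (hδ : δ ≤ 1 / 2) :
    rankinFactor k x δ / k ≤ Real.exp (δ / 2 * (3 * Real.log k - Real.log x) +
      5 * ((k : ℝ) ^ δ * ∑ p ∈ (k + 1).primesBelow, 1 / (p : ℝ)) - Real.log k) := by
  have hk0 : (1 : ℝ) ≤ k := by exact_mod_cast hk
  set σ := ∑ p ∈ (k + 1).primesBelow, 1 / (p : ℝ) with hσ
  have hσ0 : 0 ≤ σ := Finset.sum_nonneg fun p _ => by positivity
  have h1 : ((k : ℝ) ^ 3 / x) ^ (δ / 2) = Real.exp (δ / 2 * (3 * Real.log k - Real.log x)) := by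
    rw [Real.rpow_def_of_pos (by positivity), Real.log_div (by positivity) hx.ne', Real.log_pow]
    push_cast
    ring_nf
  have h2 : ∏ p ∈ (k + 1).primesBelow, (1 + (k : ℝ) ^ (δ / 2) / p) ≤
      Real.exp ((k : ℝ) ^ δ * σ) := by
    rw [hσ, Finset.mul_sum, Real.exp_sum]
    refine Finset.prod_le_prod (fun p _ => by positivity) fun p _ => ?_
    have h3 : (k : ℝ) ^ (δ / 2) ≤ (k : ℝ) ^ δ :=
      Real.rpow_le_rpow_of_exponent_le hk0 (by linarith)
    have h4 : (k : ℝ) ^ (δ / 2) / p ≤ (k : ℝ) ^ δ * (1 / p) := by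
      rw [div_eq_mul_one_div]
      exact mul_le_mul_of_nonneg_right h3 (by positivity)
    linarith [Real.add_one_le_exp ((k : ℝ) ^ δ * (1 / p))]
  have h5 := eulerProd_le_exp (k := k) hδ0 hδ
  have hE := eulerProd_pos (δ := δ) (by linarith) k
  rw [Real.exp_sub, Real.exp_log (by linarith)]
  apply div_le_div_of_nonneg_right _ (by linarith)
  have e : δ / 2 * (3 * Real.log k - Real.log x) + 5 * ((k : ℝ) ^ δ * σ) =
      δ / 2 * (3 * Real.log k - Real.log x) + 4 * ((k : ℝ) ^ δ * σ) + (k : ℝ) ^ δ * σ := by ring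
  rw [rankinFactor, h1, e, Real.exp_add, Real.exp_add]
  apply mul_le_mul (mul_le_mul_of_nonneg_left h5 (Real.exp_pos _).le) h2
    (Finset.prod_nonneg fun p _ => by positivity) (by positivity)

end PrimeSums

/-! ### Elementary asymptotics and the optimal exponent -/

section Asymptotics

open Filter Real

theorem eventually_const_mul_log_le {a c : ℝ} (hc : 0 < c) :
    ∀ᶠ X : ℝ in atTop, a * log X ≤ X ^ c := by
  have h := (isLittleO_log_rpow_atTop hc).bound (c := 1 / (|a| + 1)) (by positivity)
  filter_upwards [h, eventually_ge_atTop (1 : ℝ)] with X hX hX1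
  have hl : 0 ≤ log X := log_nonneg hX1
  rw [norm_of_nonneg hl, norm_of_nonneg (by positivity), div_mul_eq_mul_div, one_mul,
    le_div_iff₀ (by positivity)] at hX
  nlinarith [le_abs_self a]

/-- Here X stands for log n. Lower-order terms are compared with S = √(X log X) ≥ X^(1/2); for the
prime products this needs θ strictly below 1/2. -/
theorem eventually_smallness {e θ : ℝ} (he : 0 < e) (hθ0 : 0 ≤ θ) (hθ : θ < 1 / 2) :
    ∀ᶠ X : ℝ in atTop, 1 ≤ X ∧ 1 ≤ log X ∧ 8 * log X ≤ e * √(X * log X) ∧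
      5 * (X ^ θ * (5 + 4 * log (2 * √(X * log X) + 1))) ≤ e * √(X * log X) ∧
      log 18 + 2 * log (X + 3) ≤ e * √(X * log X) ∧ 2 * √(X * log X) ≤ X := by
  set c := 1 / 2 - θ with hc
  have hc0 : 0 < c := by linarith
  have hA : ∀ a : ℝ, ∀ᶠ X : ℝ in atTop, a * log X ≤ X ^ (1 / 2 : ℝ) := fun a =>
    eventually_const_mul_log_le (by norm_num)
  have hL1 : ∀ᶠ X : ℝ in atTop, 1 ≤ log X := tendsto_log_atTop.eventually_ge_atTop 1
  filter_upwards [hL1, hA (8 / e), hA (1 / e * 30), eventually_const_mul_log_le (a := 1 / e * 100) hc0,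
    eventually_const_mul_log_le (a := 4) (c := 1) one_pos, eventually_ge_atTop (3 : ℝ)]
    with X h1 h2 h3 h4 h5 hX3
  rw [rpow_one] at h5
  have hX0 : 0 < X := by linarith
  set S := √(X * log X) with hS
  have hSX : X ^ (1 / 2 : ℝ) ≤ S := by
    rw [← sqrt_eq_rpow]
    exact sqrt_le_sqrt (by nlinarith)
  have hlX : log X ≤ X := (log_le_sub_one_of_pos hX0).trans (by linarith)
  have hSleX : S ≤ X := by
    rw [hS, sqrt_le_left hX0.le]
    nlinarith
  have key : ∀ a : ℝ, (1 / e) * a ≤ S → a ≤ e * S := by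
    intro a ha
    have := mul_le_mul_of_nonneg_left ha he.le
    rwa [← mul_assoc, mul_one_div_cancel he.ne', one_mul] at this
  have hlog3X : log (3 * X) ≤ 2 * log X := by
    rw [log_mul (by norm_num) hX0.ne']
    have : log 3 ≤ log X := log_le_log (by norm_num) hX3
    linarith
  have hlog18 : log 18 ≤ 18 * log X := by
    have : log 18 ≤ 18 - 1 := log_le_sub_one_of_pos (by norm_num)
    linarith
  refine ⟨by linarith, h1, ?_, ?_, ?_, ?_⟩
  · apply key
    have : 1 / e * (8 * log X) = 8 / e * log X := by ring
    linarith
  · apply key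
    have hlog : log (2 * S + 1) ≤ 2 * log X := by
      have : log (2 * S + 1) ≤ log (3 * X) := log_le_log (by positivity) (by linarith)
      linarith
    have hb : 5 * (5 + 4 * log (2 * S + 1)) ≤ 100 * log X := by linarith
    have hXθ : 0 ≤ X ^ θ := by positivity
    calc 1 / e * (5 * (X ^ θ * (5 + 4 * log (2 * S + 1))))
        = 1 / e * X ^ θ * (5 * (5 + 4 * log (2 * S + 1))) := by ring
      _ ≤ 1 / e * X ^ θ * (100 * log X) := mul_le_mul_of_nonneg_left hb (by positivity)
      _ = X ^ θ * (1 / e * 100 * log X) := by ring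
      _ ≤ X ^ θ * X ^ c := mul_le_mul_of_nonneg_left h4 hXθ
      _ = X ^ (1 / 2 : ℝ) := by rw [← rpow_add hX0, hc]; congr 1; ring
      _ ≤ S := hSX
  · apply key
    have hlog : log (X + 3) ≤ 2 * log X := by
      have : log (X + 3) ≤ log (3 * X) := log_le_log (by positivity) (by linarith)
      linarith
    have : 1 / e * (log 18 + 2 * log (X + 3)) ≤ 1 / e * (30 * log X) :=
      mul_le_mul_of_nonneg_left (by linarith) (by positivity)
    linarith
  · have : S ≤ X / 2 := by
      rw [hS, sqrt_le_left (by positivity)]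
      nlinarith
    linarith

/-- The first term is -(1-e)²S²/(4m). If m = κ, AM-GM gives (1-e)²S²/(4m) + m ≥ (1-e)S. If m = S/4,
the first term alone is -(1-e)²S. -/
theorem exponent_le {X S κ e θ : ℝ} (hS : S ^ 2 = X * log X) (hS0 : 0 < S)
    (he0 : 0 ≤ e) (hθ : θ = (1 - e) ^ 2 / 2) (hκ : 0 ≤ κ) :
    -(θ * log X / max κ (S / 4)) / 2 * X - κ ≤ -(1 - 2 * e) * S := by
  set m := max κ (S / 4) with hm
  have hm0 : 0 < m := lt_of_lt_of_le (by positivity) (le_max_right _ _)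
  have e1 : -(θ * log X / m) / 2 * X = -((1 - e) ^ 2 * S ^ 2 / (4 * m)) := by
    rw [hS, hθ]; field_simp; ring
  rw [e1]
  rcases le_total (S / 4) κ with h | h
  · rw [max_eq_left h] at hm
    have hq : (1 - e) * S - m ≤ (1 - e) ^ 2 * S ^ 2 / (4 * m) := by
      rw [le_div_iff₀ (by positivity)]
      nlinarith [sq_nonneg ((1 - e) * S - 2 * m)]
    nlinarith
  · rw [max_eq_right h] at hm
    have hq : (1 - e) ^ 2 * S ^ 2 / (4 * m) = (1 - e) ^ 2 * S := by
      rw [hm]; field_simp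
    rw [hq]
    nlinarith [mul_nonneg (sq_nonneg e) hS0.le]

end Asymptotics

/-! ### The main estimate -/

section MainEstimate

open Filter Real

/-- The exponent δ is chosen so that k^δ ≤ (log n)^θ, which makes the prime products negligible.
Replacing log k by at least S/4 in the denominator keeps δ ≤ e/4 for small k too. -/
theorem rankinFactor_div_le_of_smallness {n k : ℕ} {e θ S : ℝ} (he : 0 < e) (he1 : e ≤ 1)
    (hn : 1 ≤ n) (hk : 2 ≤ k) (hθ : θ = (1 - e) ^ 2 / 2) (hS0 : 0 < S)
    (hS : S = √(log n * log (log n))) (hX : 1 ≤ log n) (hlX : 1 ≤ log (log n))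
    (h1 : 8 * log (log n) ≤ e * S)
    (h2 : 5 * (log n ^ θ * (5 + 4 * log (2 * S + 1))) ≤ e * S) (hkL : log k ≤ S) :
    0 ≤ θ * log (log n) / max (log k) (S / 4) ∧
      θ * log (log n) / max (log k) (S / 4) < 1 ∧
      rankinFactor k (n / exp S) (θ * log (log n) / max (log k) (S / 4)) / k ≤
        exp (-(1 - 4 * e) * S) := by
  have hk0 : (1 : ℝ) ≤ k := by exact_mod_cast (by omega : 1 ≤ k)
  have hn0 : (0 : ℝ) < n := by exact_mod_cast hn
  set X := log n with hXdef
  set κ := log k with hκ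
  have hκ0 : 0 ≤ κ := log_nonneg hk0
  set m := max κ (S / 4) with hm
  have hmκ : κ ≤ m := le_max_left _ _
  have hmS : S / 4 ≤ m := le_max_right _ _
  have hm0 : 0 < m := lt_of_lt_of_le (by positivity) hmS
  have hθ0 : 0 ≤ θ := by rw [hθ]; positivity
  have hθ1 : θ ≤ 1 / 2 := by rw [hθ]; nlinarith
  set δ := θ * log X / m with hδ
  have hδ0 : 0 ≤ δ := by positivity
  have hδm : δ * m = θ * log X := by rw [hδ]; field_simp
  have hδS : δ * S ≤ e / 4 * S := by
    have : δ * (S / 4) ≤ δ * m := mul_le_mul_of_nonneg_left hmS hδ0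
    have : θ * log X ≤ 1 / 2 * log X := mul_le_mul_of_nonneg_right hθ1 (by linarith)
    linarith
  have hδe : δ ≤ e / 4 := le_of_mul_le_mul_right hδS hS0
  have hδ12 : δ ≤ 1 / 2 := by linarith
  refine ⟨hδ0, by linarith, ?_⟩
  refine (rankinFactor_div_le (by omega) (by positivity) hδ0 hδ12).trans (exp_le_exp.2 ?_)
  have hlog : log (n / exp S) = X - S := by rw [log_div hn0.ne' (exp_pos S).ne', log_exp]
  have hσ := sum_inv_primesBelow_le (k := k) (by omega)
  set σ := ∑ p ∈ (k + 1).primesBelow, 1 / (p : ℝ)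
  have hσ' : σ ≤ 5 + 4 * log (2 * S + 1) := by
    have : log (2 * log k + 1) ≤ log (2 * S + 1) := log_le_log (by linarith) (by linarith)
    linarith
  have hkδ : (k : ℝ) ^ δ ≤ X ^ θ := by
    rw [rpow_def_of_pos (by linarith), rpow_def_of_pos (by linarith), exp_le_exp]
    have : κ * δ ≤ m * δ := mul_le_mul_of_nonneg_right hmκ hδ0
    linarith
  have hσ0 : 0 ≤ σ := Finset.sum_nonneg fun p _ => by positivity
  have hprod : 5 * ((k : ℝ) ^ δ * σ) ≤ e * S := by
    refine le_trans ?_ h2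
    have := mul_le_mul hkδ hσ' hσ0 (by positivity)
    linarith
  have hSq : S ^ 2 = X * log X := by
    rw [hS, sq_sqrt (by nlinarith)]
  have hmain := exponent_le hSq hS0 he.le hθ hκ0
  rw [← hm, ← hδ] at hmain
  have hδκ : δ * κ ≤ δ * S := mul_le_mul_of_nonneg_left hkL hδ0
  rw [hlog, ← hκ]
  have e1 : δ / 2 * (3 * κ - (X - S)) + 5 * ((k : ℝ) ^ δ * σ) - κ =
      (-δ / 2 * X - κ) + (3 / 2 * (δ * κ) + 1 / 2 * (δ * S)) + 5 * ((k : ℝ) ^ δ * σ) := by ring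
  rw [e1]
  nlinarith

theorem eventually_abs_log_coverCount_sub_le {ε : ℝ} (hε : 0 < ε) (hε1 : ε ≤ 1) :
    ∀ᶠ n : ℕ in atTop, |log (coverCount (Finset.Icc 1 n)) - n * logGrowth| ≤
      n * exp ((-1 + ε) * √(log n * log (log n))) := by
  -- Four parts of `e` are lost in the Rankin bound; the fifth absorbs 18(log n + 3)².
  set e := ε / 5 with he
  have he0 : 0 < e := by positivity
  have he1 : e ≤ 1 := by linarith
  set θ := (1 - e) ^ 2 / 2 with hθ
  have hθ1 : θ < 1 / 2 := by rw [hθ]; nlinarith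
  have hev := (tendsto_log_atTop.comp tendsto_natCast_atTop_atTop).eventually
    (eventually_smallness he0 (by positivity) hθ1)
  filter_upwards [hev, eventually_ge_atTop 1] with n hn hn1
  simp only [Function.comp_apply] at hn
  obtain ⟨hX, hlX, h1, h2, h3, h4⟩ := hn
  have hn0 : (1 : ℝ) ≤ n := by exact_mod_cast hn1
  set X := log (n : ℝ) with hXdef
  set S := √(X * log X) with hS
  have hS0 : 0 < S := sqrt_pos.2 (by positivity)
  have hnX : (n : ℝ) = exp X := (exp_log (by linarith)).symm
  have hL1 : 1 ≤ exp S := one_le_exp hS0.le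
  have hLn : exp S ≤ n := by rw [hnX, exp_le_exp]; linarith
  have hmain := abs_log_coverCount_sub_le' hn1 hL1 hLn (E := exp (-(1 - 4 * e) * S))
    (fun k => θ * log X / max (log k) (S / 4)) (fun k hk hkL =>
      rankinFactor_div_le_of_smallness he0 he1 hn1 hk hθ hS0 hS hX hlX h1 h2
        (by rw [log_le_iff_le_exp (by exact_mod_cast (by omega : 0 < k))]; exact hkL))
    (exp_pos _).le
  refine hmain.trans ?_
  rw [← hXdef]
  set M := X + 3 with hM
  set E := exp (-(1 - 4 * e) * S) with hE
  have hE0 : 0 < E := exp_pos _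
  have hM1 : 1 ≤ M := by linarith
  have hinv : 1 / exp S ≤ E := by
    rw [one_div, ← exp_neg, hE, exp_le_exp]; nlinarith
  have hLnE : exp S ≤ n * E := by
    refine le_trans ?_ (mul_le_mul_of_nonneg_left hinv (by linarith))
    rw [mul_one_div, le_div_iff₀ (exp_pos S), ← exp_add, hnX, exp_le_exp]
    linarith
  have hM18 : 18 * M ^ 2 ≤ exp (e * S) := by
    rw [← log_le_iff_le_exp (by positivity), log_mul (by norm_num) (by positivity), log_pow]
    push_cast
    exact h3
  have hfin : (n : ℝ) * exp ((-1 + ε) * S) = n * (exp (e * S) * E) := by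
    rw [hE, ← exp_add]
    congr 2
    rw [he]; ring
  rw [hfin]
  have hMM : M ≤ M ^ 2 := by nlinarith
  calc 2 * M * exp S + n * M ^ 2 * (8 / exp S + 8 * E)
      = 2 * M * exp S + n * M ^ 2 * (8 * (1 / exp S) + 8 * E) := by ring
    _ ≤ 2 * M ^ 2 * (n * E) + n * M ^ 2 * (8 * E + 8 * E) := by gcongr
    _ = n * (18 * M ^ 2 * E) := by ring
    _ ≤ n * (exp (e * S) * E) := by gcongr

end MainEstimate

/-! ### Primitive recursiveness of the count -/

section Counting

/-- The base-`n` digits of `a` list the values (shifted by one) of a permutation of `{1, …, n}`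
along which consecutive elements divide one another. -/
def IsDivCode (a n : ℕ) : Prop :=
  (∀ i < n, i + 1 ∣ a / n ^ i % n + 1 ∨ a / n ^ i % n + 1 ∣ i + 1) ∧
    ∀ i < n, ∀ j < n, a / n ^ i % n = a / n ^ j % n → i = j

open Classical in
/-- The number of codes below `n ^ n`. -/
noncomputable def divCodeCount (n : ℕ) : ℕ :=
  ((List.range (n ^ n)).filter fun a => IsDivCode a n).length

theorem primrec_pow : Primrec₂ ((· ^ ·) : ℕ → ℕ → ℕ) := Primrec₂.unpaired'.1 Nat.Primrec.pow

theorem PrimrecRel.forall_lt_of_prod {β : Type*} [Primcodable β] {R : ℕ → β → Prop}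
    (hR : PrimrecRel R) : PrimrecRel fun n y => ∀ x < n, R x y :=
  (hR.forall_mem_list.comp (Primrec.list_range.comp Primrec.fst) Primrec.snd).of_eq (by simp)

theorem primrecRel_dvd : PrimrecRel ((· ∣ ·) : ℕ → ℕ → Prop) :=
  PrimrecRel.of_eq (r := fun a b : ℕ => b % a = 0)
    (Primrec.eq.comp (Primrec.nat_mod.comp Primrec.snd Primrec.fst) (Primrec.const 0))
    fun _ _ => (Nat.dvd_iff_mod_eq_zero ..).symm

theorem primrecRel_isDivCode : PrimrecRel IsDivCode := by
  have hdigit : Primrec₂ fun (i : ℕ) (p : ℕ × ℕ) => p.1 / p.2 ^ i % p.2 :=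
    Primrec.nat_mod.comp (Primrec.nat_div.comp (Primrec.fst.comp Primrec.snd)
      (primrec_pow.comp (Primrec.snd.comp Primrec.snd) Primrec.fst))
      (Primrec.snd.comp Primrec.snd)
  have h1 : PrimrecRel fun (i : ℕ) (p : ℕ × ℕ) =>
      i + 1 ∣ p.1 / p.2 ^ i % p.2 + 1 ∨ p.1 / p.2 ^ i % p.2 + 1 ∣ i + 1 :=
    PrimrecPred.or
      (primrecRel_dvd.comp (Primrec.succ.comp Primrec.fst) (Primrec.succ.comp hdigit))
      (primrecRel_dvd.comp (Primrec.succ.comp hdigit) (Primrec.succ.comp Primrec.fst))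
  have h2 : PrimrecRel fun (j : ℕ) (q : ℕ × ℕ × ℕ) =>
      q.2.1 / q.2.2 ^ q.1 % q.2.2 = q.2.1 / q.2.2 ^ j % q.2.2 → q.1 = j :=
    PrimrecPred.of_eq (PrimrecPred.or
      (PrimrecPred.not (Primrec.eq.comp
        (hdigit.comp (Primrec.fst.comp Primrec.snd) (Primrec.snd.comp Primrec.snd))
        (hdigit.comp Primrec.fst (Primrec.snd.comp Primrec.snd))))
      (Primrec.eq.comp (Primrec.fst.comp Primrec.snd) Primrec.fst)) fun _ => imp_iff_not_or.symm
  have h3 : PrimrecRel fun (i : ℕ) (p : ℕ × ℕ) =>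
      ∀ j < p.2, p.1 / p.2 ^ i % p.2 = p.1 / p.2 ^ j % p.2 → i = j :=
    h2.forall_lt_of_prod.comp (Primrec.snd.comp Primrec.snd) Primrec.id
  exact PrimrecPred.and (h1.forall_lt_of_prod.comp Primrec.snd Primrec.id)
    (h3.forall_lt_of_prod.comp Primrec.snd Primrec.id)

theorem primrec_divCodeCount : Primrec divCodeCount := by
  classical
  exact Primrec.list_length.comp (primrecRel_isDivCode.listFilter.comp
    (Primrec.list_range.comp (primrec_pow.comp Primrec.id Primrec.id)) Primrec.id)

/-- Permutations of `{1, …, n}` as injective self-maps of `Fin n`. -/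
noncomputable def permIccEquiv (n : ℕ) :
    Equiv.Perm (Finset.Icc 1 n) ≃ {f : Fin n → Fin n // Function.Injective f} :=
  let e : Finset.Icc 1 n ≃ Fin n :=
    { toFun := fun x => ⟨x - 1, by have := Finset.mem_Icc.1 x.2; omega⟩
      invFun := fun i => ⟨i + 1, Finset.mem_Icc.2 (by omega)⟩
      left_inv := fun x => Subtype.ext (by
        have := Finset.mem_Icc.1 x.2; change (x : ℕ) - 1 + 1 = x; omega)
      right_inv := fun i => Fin.ext (by simp) }
  e.permCongr.trans
    { toFun := fun π => ⟨π, π.injective⟩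
      invFun := fun f => Equiv.ofBijective f.1 (Finite.injective_iff_bijective.1 f.2)
      left_inv := fun _ => Equiv.ext fun _ => rfl
      right_inv := fun _ => rfl }

theorem permIccEquiv_apply {n : ℕ} (π : Equiv.Perm (Finset.Icc 1 n)) (i : Fin n) :
    (((permIccEquiv n π).1 i : Fin n) : ℕ) + 1 =
      π ⟨i + 1, Finset.mem_Icc.2 (by omega)⟩ := by
  have := Finset.mem_Icc.1 (π ⟨i + 1, Finset.mem_Icc.2 (by omega)⟩).2
  change ((π ⟨i + 1, _⟩ : Finset.Icc 1 n) : ℕ) - 1 + 1 = _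
  omega

theorem card_Sdiv_eq_divCodeCount (n : ℕ) : (Sdiv n).card = divCodeCount n := by
  classical
  have h1 : (Sdiv n).card = Fintype.card {f : Fin n → Fin n // Function.Injective f ∧
      ∀ i : Fin n, (i : ℕ) + 1 ∣ f i + 1 ∨ (f i : ℕ) + 1 ∣ i + 1} := by
    rw [Sdiv, ← Fintype.card_subtype]
    refine Fintype.card_congr (((permIccEquiv n).subtypeEquiv fun π => ?_).trans
      (Equiv.subtypeSubtypeEquivSubtypeInter _
        fun f : Fin n → Fin n => ∀ i : Fin n, (i : ℕ) + 1 ∣ f i + 1 ∨ (f i : ℕ) + 1 ∣ i + 1))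
    refine ⟨fun h i => ?_, fun h j => ?_⟩
    · rw [permIccEquiv_apply]
      exact h ⟨i + 1, Finset.mem_Icc.2 (by omega)⟩
    · obtain ⟨j, hj⟩ := j
      have hj' := Finset.mem_Icc.1 hj
      have := h ⟨j - 1, by omega⟩
      rw [permIccEquiv_apply] at this
      simpa only [Nat.sub_add_cancel hj'.1] using this
  have h2 : divCodeCount n = Fintype.card {a : Fin (n ^ n) // IsDivCode a n} := by
    rw [Fintype.card_subtype, divCodeCount, ← List.toFinset_card_of_nodup
      (List.nodup_range.filter _), ← Finset.card_map Fin.valEmbedding]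
    congr 1
    ext a
    simp only [List.mem_toFinset, List.mem_filter, List.mem_range, decide_eq_true_eq,
      Finset.mem_map, Finset.mem_filter, Finset.mem_univ, true_and, Fin.valEmbedding_apply]
    exact ⟨fun h => ⟨⟨a, h.1⟩, h.2, rfl⟩, by rintro ⟨b, hb, rfl⟩; exact ⟨b.2, hb⟩⟩
  rw [h1, h2]
  refine (Fintype.card_congr (finFunctionFinEquiv.symm.subtypeEquiv fun a => ?_)).symm
  have hv : ∀ i : Fin n, (finFunctionFinEquiv.symm a i : ℕ) = a / n ^ (i : ℕ) % n := fun i => rfl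
  simp only [IsDivCode, Function.Injective, Fin.ext_iff, hv, Fin.forall_iff]
  exact ⟨fun h => ⟨fun i hi j hj => h.2 i hi j hj, h.1⟩, fun h => ⟨h.2, fun i hi j hj => h.1 i hi j hj⟩⟩

theorem primrec_card_Sdiv : Primrec fun n => (Sdiv n).card :=
  primrec_divCodeCount.of_eq fun n => (card_Sdiv_eq_divCodeCount n).symm

theorem primrec_natCast_int : Primrec ((↑) : ℕ → ℤ) := by
  -- A nonnegative integer n has code 2n.
  refine Primrec.encode_iff.1 (Primrec.nat_double.of_eq fun n => ?_)
  rfl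

end Counting

/-! ### Computability and convergence of the n-th roots -/

section Computability

open Filter Real

/-- Bounded search finds ⌊2^(k+1) Z^(1/N)⌋ as the largest b with b^N ≤ 2^((k+1)N) Z; the search
bound suffices because Z ≤ Z^N. Rounding uses half of the allowed error, the hypothesis the other
half. -/
theorem isEffectivelyComputable_of_root {Z N : ℕ → ℕ} (hZ : Primrec Z) (hN : Primrec N)
    (hN0 : ∀ k, 0 < N k) {c : ℝ}
    (h : ∀ k, |(Z (N k) : ℝ) ^ (1 / (N k : ℝ)) - c| ≤ 1 / 2 ^ (k + 1)) :
    IsEffectivelyComputable c := by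
  have hq : Primrec fun k : ℕ => 2 ^ (k + 1) := primrec_pow.comp (Primrec.const 2) Primrec.succ
  have hW : Primrec fun k => Z (N k) := hZ.comp hN
  have hp : Primrec fun k => Nat.findGreatest
      (fun b => b ^ N k ≤ (2 ^ (k + 1)) ^ N k * Z (N k)) (2 ^ (k + 1) * Z (N k)) :=
    Primrec.nat_findGreatest (p := fun k b => b ^ N k ≤ (2 ^ (k + 1)) ^ N k * Z (N k))
      (Primrec.nat_mul.comp hq hW)
      (Primrec.nat_le.comp (primrec_pow.comp Primrec.snd (hN.comp Primrec.fst))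
        (Primrec.nat_mul.comp
          (primrec_pow.comp (hq.comp Primrec.fst) (hN.comp Primrec.fst)) (hW.comp Primrec.fst)))
  refine ⟨_, _, (primrec_natCast_int.comp hp).to_comp, hq.to_comp, fun k => ⟨by positivity, ?_⟩⟩
  set P : ℕ → Prop := fun b => b ^ N k ≤ (2 ^ (k + 1)) ^ N k * Z (N k) with hP
  set b := Nat.findGreatest P (2 ^ (k + 1) * Z (N k)) with hb
  have hle : b ^ N k ≤ (2 ^ (k + 1)) ^ N k * Z (N k) :=
    Nat.findGreatest_spec (P := P) (Nat.zero_le _) (by simp [hP, (hN0 k).ne'])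
  have hlt : (2 ^ (k + 1)) ^ N k * Z (N k) < (b + 1) ^ N k := by
    by_cases hbd : b + 1 ≤ 2 ^ (k + 1) * Z (N k)
    · exact not_le.1 (Nat.findGreatest_is_greatest (P := P) (Nat.lt_succ_self b) hbd)
    · calc (2 ^ (k + 1)) ^ N k * Z (N k) ≤ (2 ^ (k + 1)) ^ N k * Z (N k) ^ N k := by
            gcongr; exact Nat.le_self_pow (hN0 k).ne' _
        _ = (2 ^ (k + 1) * Z (N k)) ^ N k := (mul_pow ..).symm
        _ < (b + 1) ^ N k := Nat.pow_lt_pow_left (not_le.1 hbd) (hN0 k).ne'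
  set x : ℝ := (Z (N k) : ℝ) ^ (1 / (N k : ℝ)) with hx
  have hx0 : 0 ≤ x := by positivity
  have hxN : x ^ N k = Z (N k) := by
    rw [hx, one_div]; exact rpow_inv_natCast_pow (Nat.cast_nonneg _) (hN0 k).ne'
  have hle' : (b : ℝ) ≤ 2 ^ (k + 1) * x := by
    refine le_of_pow_le_pow_left₀ (hN0 k).ne' (by positivity) ?_
    rw [mul_pow, hxN]; exact_mod_cast hle
  have hlt' : 2 ^ (k + 1) * x < (b : ℝ) + 1 := by
    refine lt_of_pow_lt_pow_left₀ (N k) (by positivity) ?_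
    rw [mul_pow, hxN]; exact_mod_cast hlt
  have h2 : (0 : ℝ) < 2 ^ (k + 1) := by positivity
  have hclose : |x - b / 2 ^ (k + 1)| ≤ 1 / 2 ^ (k + 1) := by
    have : x - b / 2 ^ (k + 1) = (2 ^ (k + 1) * x - b) / 2 ^ (k + 1) := by field_simp
    rw [this, abs_div, abs_of_pos h2]
    gcongr
    rw [abs_le]; constructor <;> linarith
  push_cast
  calc |c - b / 2 ^ (k + 1)| ≤ |c - x| + |x - b / 2 ^ (k + 1)| := abs_sub_le _ _ _
    _ ≤ 1 / 2 ^ (k + 1) + 1 / 2 ^ (k + 1) := add_le_add (abs_sub_comm c x ▸ h k) hclose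
    _ = 1 / 2 ^ k := by rw [pow_succ]; field_simp; norm_num

theorem abs_exp_sub_exp_le {x y : ℝ} (h : |y - x| ≤ 1) :
    |exp y - exp x| ≤ 2 * exp x * |y - x| := by
  have h1 := abs_exp_sub_one_le h
  have h2 : exp y - exp x = exp x * (exp (y - x) - 1) := by rw [exp_sub]; field_simp
  rw [h2, abs_mul, abs_of_pos (exp_pos x)]
  nlinarith [exp_pos x]

theorem card_Sdiv_pos (n : ℕ) : 0 < (Sdiv n).card := by
  rw [card_Sdiv]; exact coverCount_pos _

/-- A crude rate suffices here: ε = 1/2, with the factor log log n dropped. -/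
theorem eventually_abs_card_Sdiv_root_sub_le :
    ∀ᶠ n : ℕ in atTop, |((Sdiv n).card : ℝ) ^ (1 / (n : ℝ)) - exp logGrowth| ≤
      2 * exp logGrowth * exp (-(1 / 2) * √(log n)) := by
  have hlog : Tendsto (fun n : ℕ => log n) atTop atTop :=
    tendsto_log_atTop.comp tendsto_natCast_atTop_atTop
  filter_upwards [eventually_abs_log_coverCount_sub_le (ε := 1 / 2) (by norm_num) (by norm_num),
    hlog.eventually_ge_atTop 0, (tendsto_log_atTop.comp hlog).eventually_ge_atTop 1,
    eventually_gt_atTop 0] with n h h0 h1 hn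
  rw [← card_Sdiv] at h
  have hn0 : (0 : ℝ) < n := by exact_mod_cast hn
  have hS : √(log n) ≤ √(log n * log (log n)) :=
    sqrt_le_sqrt (le_mul_of_one_le_right h0 h1)
  have hd : |log (Sdiv n).card * (1 / n) - logGrowth| ≤ exp (-(1 / 2) * √(log n)) := by
    have : log (Sdiv n).card * (1 / n) - logGrowth =
        (log (Sdiv n).card - n * logGrowth) / n := by field_simp
    rw [this, abs_div, abs_of_pos hn0, div_le_iff₀ hn0, mul_comm (exp _)]
    refine h.trans ?_
    gcongr ?_ * exp ?_
    linarith
  rw [rpow_def_of_pos (by exact_mod_cast card_Sdiv_pos n)]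
  refine (abs_exp_sub_exp_le (hd.trans (exp_le_one_iff.2 ?_))).trans (by gcongr)
  have := sqrt_nonneg (log n)
  linarith

/-- At N = 2^(m²) the quantity √(log N) is linear in m, so an m linear in k gives accuracy 2^(-k-1).
The fixed number `a` absorbs both the threshold `n₁` and the factor 2·exp `logGrowth`. -/
theorem isEffectivelyComputable_exp_logGrowth : IsEffectivelyComputable (exp logGrowth) := by
  obtain ⟨n₁, hn₁⟩ := eventually_atTop.1 eventually_abs_card_Sdiv_root_sub_le
  -- The error decays at least like exp(-(2/5)m), since 1/2 · 4/5 = 2/5; the factor 5/2 inverts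
  -- this.
  obtain ⟨a, ha⟩ := exists_nat_ge (max (n₁ : ℝ) (5 / 2 * (logGrowth + log 2)))
  have ha1 : n₁ ≤ a := by exact_mod_cast (le_max_left _ _).trans ha
  have ha2 := (le_max_right _ _).trans ha
  have hm : Primrec fun k : ℕ => 2 * (k + 1) + a :=
    Primrec.nat_add.comp (Primrec.nat_mul.comp (Primrec.const 2) Primrec.succ) (Primrec.const a)
  refine isEffectivelyComputable_of_root (N := fun k => 2 ^ (2 * (k + 1) + a) ^ 2)
    primrec_card_Sdiv
    (primrec_pow.comp (Primrec.const 2) (primrec_pow.comp hm (Primrec.const 2)))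
    (fun k => by positivity) fun k => ?_
  set m := 2 * (k + 1) + a with hmdef
  have hN : n₁ ≤ 2 ^ m ^ 2 :=
    calc n₁ ≤ m := by omega
      _ ≤ m ^ 2 := Nat.le_self_pow two_ne_zero m
      _ ≤ 2 ^ m ^ 2 := Nat.lt_two_pow_self.le
  refine (hn₁ _ hN).trans ?_
  have hl2 := log_two_gt_d9
  have hl2' := log_two_lt_d9
  -- Holds because (4/5)² < log 2.
  have hsqrt : (4 / 5 : ℝ) * m ≤ √(log ((2 ^ m ^ 2 : ℕ) : ℝ)) := by
    apply le_sqrt_of_sq_le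
    push_cast
    rw [log_pow, mul_pow, mul_comm]
    push_cast
    gcongr
    linarith
  have hpow : (1 : ℝ) / 2 ^ (k + 1) = exp (-((k + 1 : ℝ) * log 2)) := by
    rw [exp_neg, one_div, ← rpow_natCast, rpow_def_of_pos two_pos]
    push_cast
    rw [mul_comm]
  have h2 : (2 : ℝ) * exp logGrowth = exp (log 2 + logGrowth) := by
    rw [exp_add, exp_log two_pos]
  rw [hpow, h2, ← exp_add, exp_le_exp]
  have hmc : (m : ℝ) = 2 * (k + 1) + a := by rw [hmdef]; push_cast; ring
  have hk : ((k : ℝ) + 1) * log 2 ≤ (k + 1) * (4 / 5) := by gcongr; linarith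
  rw [hmc] at hsqrt
  linarith

theorem tendsto_card_Sdiv_root :
    Tendsto (fun n : ℕ => ((Sdiv n).card : ℝ) ^ (1 / (n : ℝ))) atTop (nhds (exp logGrowth)) := by
  rw [tendsto_iff_norm_sub_tendsto_zero]
  have hlog : Tendsto (fun n : ℕ => √(log n)) atTop atTop :=
    tendsto_sqrt_atTop.comp (tendsto_log_atTop.comp tendsto_natCast_atTop_atTop)
  have h0 : Tendsto (fun n : ℕ => 2 * exp logGrowth * exp (-(1 / 2) * √(log n))) atTop
      (nhds (2 * exp logGrowth * 0)) :=
    (tendsto_exp_atBot.comp (hlog.const_mul_atTop_of_neg (by norm_num))).const_mul _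
  rw [mul_zero] at h0
  exact squeeze_zero' (Eventually.of_forall fun _ => norm_nonneg _)
    eventually_abs_card_Sdiv_root_sub_le h0

end Computability

/-! ### Conclusion -/

theorem theorem2p2 :
    ∃ c : ℝ,
      IsEffectivelyComputable c ∧
      Filter.Tendsto (fun n : ℕ => ((Sdiv n).card : ℝ) ^ (1 / (n : ℝ))) Filter.atTop (nhds c) ∧
      ∀ ε : ℝ, 0 < ε →
        ∃ E : ℕ → ℝ,
          E =O[Filter.atTop] (fun n : ℕ =>
            Real.exp ((-1 + ε) * Real.sqrt (Real.log n * Real.log (Real.log n)))) ∧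
          ∀ n : ℕ, ((Sdiv n).card : ℝ) = c ^ ((n : ℝ) * (1 + E n)) := by
  -- The error function is obtained by solving the required identity for it.
  refine ⟨Real.exp logGrowth, isEffectivelyComputable_exp_logGrowth, tendsto_card_Sdiv_root,
    fun ε hε => ⟨fun n => Real.log (Sdiv n).card / (n * logGrowth) - 1, ?_, fun n => ?_⟩⟩
  · refine Asymptotics.IsBigO.of_bound (1 / logGrowth) ?_
    -- The main estimate assumes ε ≤ 1; a larger ε only weakens the claim.
    filter_upwards [eventually_abs_log_coverCount_sub_le (lt_min hε one_pos) (min_le_right ε 1),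
      Filter.eventually_gt_atTop 0] with n h hn
    have hn0 : (0 : ℝ) < n := by exact_mod_cast hn
    have hg := logGrowth_pos
    rw [← card_Sdiv] at h
    have heq : Real.log (Sdiv n).card / (n * logGrowth) - 1 =
        (Real.log (Sdiv n).card - n * logGrowth) / (n * logGrowth) := by field_simp
    rw [heq, Real.norm_eq_abs, abs_div, abs_of_pos (by positivity : 0 < n * logGrowth),
      Real.norm_eq_abs, Real.abs_exp, div_le_iff₀ (by positivity)]
    refine h.trans (le_of_le_of_eq (b := n * Real.exp ((-1 + ε) *
      Real.sqrt (Real.log n * Real.log (Real.log n)))) ?_ (by field_simp))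
    gcongr
    exact min_le_left ε 1
  · rw [← Real.exp_mul]
    rcases n.eq_zero_or_pos with rfl | hn
    -- At n = 0 the exponent vanishes and both sides equal 1.
    · simp [card_Sdiv, coverCount_empty]
    · have hn0 : (n : ℝ) ≠ 0 := by exact_mod_cast hn.ne'
      have hg := logGrowth_pos.ne'
      have : logGrowth * (n * (1 + (Real.log (Sdiv n).card / (n * logGrowth) - 1))) =
          Real.log (Sdiv n).card := by field_simp; ring
      rw [this, Real.exp_log (by exact_mod_cast card_Sdiv_pos n)]
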